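/- Let $G=(V,E)$ be an infinite graph. In the firefighter game on $G$ with budget $f:\{1,2,\dots\}\to\mathbb{R}$, a finite set $B(0)\subset V$ of vertices is initially burning. At each turn $t=1,2,\dots$ the player permanently protects a finite set of non-burning vertices, so that at most $f(t)$ vertices in total are protected by turn $t$; then every unprotected neighbour of a burning vertex starts burning, and burning vertices burn forever. The player contains the fire if from some turn on no new vertex starts burning. A real number $C$ is the critical protection rate of $G$, written $C(G)=C$, if for $f(t)=Ct$ there is a finite initial set $B(0)$ whose fire the player cannot contain, while for every $\varepsilon>0$ and $f(t)=(C+\varepsilon)t$ the player can contain the fire from every finite initial set $B(0)$. Let $\mathbb{Z}$ denote the bi-infinite path ($m,n$ adjacent iff $|m-n|=1$) and $[h]$ the path on $\{1,\dots,h\}$ with consecutive integers adjacent. Let $\Box$ and $\boxtimes$ denote the Cartesian and the strong product of graphs (in $G\boxtimes H$, distinct vertices are adjacent iff in each coordinate they are equal or adjacent). Then for every integer $h\ge 1$, $$C\big((\mathbb{Z}\,\Box\,\mathbb{Z})\boxtimes[h]\big)=\tfrac32 h\qquad\text{and}\qquad C\big((\mathbb{Z}\boxtimes\mathbb{Z})\boxtimes[h]\big)=3h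 .$$ -/

import Mathlib

namespace SimpleGraph

/-- The strong product of two simple graphs: distinct pairs are adjacent when, in each coordinate,
they are equal or adjacent. -/
def strongProd {α β : Type*} (G : SimpleGraph α) (H : SimpleGraph β) : SimpleGraph (α × β) where
  Adj x y := x ≠ y ∧ (x.1 = y.1 ∨ G.Adj x.1 y.1) ∧ (x.2 = y.2 ∨ H.Adj x.2 y.2)
  symm := ⟨fun _ _ h => ⟨h.1.symm, h.2.1.imp Eq.symm SimpleGraph.Adj.symm, h.2.2.imp Eq.symm SimpleGraph.Adj.symm⟩⟩
  loopless := ⟨fun _ h => h.1 rfl⟩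

end SimpleGraph

namespace Firefighter

variable {V : Type*}

/-- `burning G B₀ F t` is the set of vertices burning after turn `t`, for the initial fire `B₀`,
when `F t` is the set of vertices protected during the turns `1, …, t`. In turn `t + 1` the player
protects first; then all unprotected neighbours of burning vertices catch fire. -/
def burning (G : SimpleGraph V) (B₀ : Set V) (F : ℕ → Finset V) : ℕ → Set V
  | 0 => B₀
  | t + 1 => burning G B₀ F t ∪
      {v | v ∉ F (t + 1) ∧ ∃ u ∈ burning G B₀ F t, G.Adj u v}

/-- `F` is a legal play against the initial fire `B₀` with budget `f`: protection is permanent,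
only non-burning vertices get protected, and at most `f t` vertices are protected by turn `t`. -/
structure IsLegalPlay (G : SimpleGraph V) (B₀ : Set V) (f : ℕ → ℝ) (F : ℕ → Finset V) :
    Prop where
  start : F 0 = ∅
  mono : Monotone F
  notBurning : ∀ t, ∀ v ∈ F (t + 1), v ∉ F t → v ∉ burning G B₀ F t
  budget : ∀ t, 1 ≤ t → ((F t).card : ℝ) ≤ f t

/-- The play `F` contains the fire: from some turn on no new vertex starts burning. -/
def Contains (G : SimpleGraph V) (B₀ : Set V) (F : ℕ → Finset V) : Prop :=
  ∃ T, ∀ t, T ≤ t → burning G B₀ F t = burning G B₀ F T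

/-- With budget `f` the player can contain the fire that starts at `B₀`. -/
def Containable (G : SimpleGraph V) (f : ℕ → ℝ) (B₀ : Set V) : Prop :=
  ∃ F : ℕ → Finset V, IsLegalPlay G B₀ f F ∧ Contains G B₀ F

/-- `C` is the critical protection rate of `G`: with budget `C * t` some finite initial fire cannot
be contained, and with budget `(C + ε) * t`, for any `ε > 0`, every finite initial fire can. -/
def IsCriticalProtectionRate (G : SimpleGraph V) (C : ℝ) : Prop :=
  (∃ B₀ : Set V, B₀.Finite ∧ ¬ Containable G (fun t => C * t) B₀) ∧
    ∀ ε : ℝ, 0 < ε → ∀ B₀ : Set V, B₀.Finite → Containable G (fun t => (C + ε) * t) B₀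

/-- The bi-infinite path on the integers: `m` and `n` are adjacent when `|m - n| = 1`. -/
noncomputable abbrev intPath : SimpleGraph ℤ := SimpleGraph.hasse ℤ

end Firefighter

/-!
In suitable coordinates a free fire is a rectangle whose four sides advance by one each turn. A
fire that occupies enough of a side reaches at least `g` more vertices of the next row, and a side
has `g / 2` vertices per unit length.

Lower bound. The number of protected vertices in the rectangle plus the number of burning vertices
on its frame increases by `g` for every advancing side, whatever the player does. Suppose the budget
is `3 * g / 2` per turn and the initial fire is large. The burning vertices of a side that is held
are matched by protected ones in the row just outside. So if two adjacent sides were held at once,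
only the other two, which make up half the perimeter, could contribute to the potential without
protection, and the budget would be exceeded. Two opposite sides are excluded after averaging with a
potential for the strip between them. Hence at least three sides advance in every turn.

Upper bound. Four walls are built one after another in cyclic order, at distances that increase
quickly. When the fire has reached distance `s`, at most three half-sides of the square of radius
`s` are protected, up to lower order terms that `ε` pays for, and a half-side has `g * s / 2`
vertices.

The coordinates are `x ± y` on `ℤ □ ℤ` and `x`, `y` on `ℤ ⊠ ℤ`, where the gains `g = 1` and `g = 2`
are the one-dimensional Cauchy–Davenport inequality. A strong product with a connected graph on `h`
vertices multiplies the gain by `h`: if the fire is spread evenly over the layers, each layer gains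
`g` separately, and otherwise the jump between two adjacent layers provides the gain.
-/

namespace Firefighter

open Set

section Counting

variable {α ι : Type*}

theorem ncard_inter_le_add {A X Y Z : Set α} (hZ : Z ⊆ X ∪ Y) (hX : X.Finite) (hY : Y.Finite) :
    (A ∩ Z).ncard ≤ (A ∩ X).ncard + (A ∩ Y).ncard := by
  refine (ncard_le_ncard (t := A ∩ X ∪ A ∩ Y) ?_ ?_).trans (ncard_union_le _ _)
  · rw [← inter_union_distrib_left]
    exact inter_subset_inter_right A hZ
  · exact (hX.inter_of_right A).union (hY.inter_of_right A)

theorem sum_ncard_inter_le {X : ι → Set α} {A Z : Set α} {s : Finset ι}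
    (hdisj : ∀ i ∈ s, ∀ j ∈ s, i ≠ j → Disjoint (X i) (X j)) (hX : ∀ i ∈ s, X i ⊆ Z)
    (hfin : (A ∩ Z).Finite) : ∑ i ∈ s, (A ∩ X i).ncard ≤ (A ∩ Z).ncard := by
  have hsub : ∀ i ∈ s, A ∩ X i ⊆ A ∩ Z := fun i hi => inter_subset_inter_right A (hX i hi)
  rw [← finsum_mem_coe_finset, ← s.finite_toSet.ncard_biUnion (fun i hi => hfin.subset (hsub i hi))
    fun i hi j hj hij => (hdisj i hi j hj hij).mono inter_subset_right inter_subset_right]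
  exact ncard_le_ncard (iUnion₂_subset hsub) hfin

theorem ncard_inter_add_le {A X Y Z : Set α} (hXY : Disjoint X Y) (hX : X ⊆ Z) (hY : Y ⊆ Z)
    (hfin : (A ∩ Z).Finite) : (A ∩ X).ncard + (A ∩ Y).ncard ≤ (A ∩ Z).ncard := by
  rw [← ncard_union_eq (hXY.mono inter_subset_right inter_subset_right)
    (hfin.subset (inter_subset_inter_right A hX)) (hfin.subset (inter_subset_inter_right A hY))]
  exact ncard_le_ncard (union_subset (inter_subset_inter_right A hX)
    (inter_subset_inter_right A hY)) hfin

end Counting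

section Geometry

variable {V : Type*}

/-- The vertices `v` with `z i v ≤ r i` in each of four directions. Throughout, directions are
numbered cyclically, so that `i + 2` is the direction opposite to `i`, with `z (i + 2) = -z i`;
the rectangle then has extent `r i + r (i + 2)` in direction `i`. -/
def rect (z : Fin 4 → V → ℤ) (r : Fin 4 → ℤ) : Set V :=
  {v | ∀ i, z i v ≤ r i}

/-- The side of a rectangle that faces direction `i`, including its two corners. -/
def side (z : Fin 4 → V → ℤ) (r : Fin 4 → ℤ) (i : Fin 4) : Set V :=
  {v | v ∈ rect z r ∧ z i v = r i}

/-- The side of a rectangle that faces direction `i`, without its two corners. -/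
def openSide (z : Fin 4 → V → ℤ) (r : Fin 4 → ℤ) (i : Fin 4) : Set V :=
  {v | v ∈ side z r i ∧ ∀ j, z j v = r j → j = i}

/-- The boundary of a rectangle, as the union of its four sides. -/
def frame (z : Fin 4 → V → ℤ) (r : Fin 4 → ℤ) : Set V :=
  {v | ∃ i, v ∈ side z r i}

/-- The rectangle `r` with the sides in the directions `S` pushed out by one. -/
def advance (r : Fin 4 → ℤ) (S : Finset (Fin 4)) (i : Fin 4) : ℤ :=
  if i ∈ S then r i + 1 else r i

/-- The row of vertices just outside the side `i` of a rectangle. -/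
def front (z : Fin 4 → V → ℤ) (r : Fin 4 → ℤ) (i : Fin 4) : Set V :=
  side z (advance r {i}) i

/-- The vertices of the front in direction `i` that a fire at `A` reaches in one turn. -/
def exits (G : SimpleGraph V) (z : Fin 4 → V → ℤ) (r : Fin 4 → ℤ) (i : Fin 4) (A : Set V) : Set V :=
  {v | v ∈ front z r i ∧ ∃ u ∈ A, G.Adj u v}

variable {z : Fin 4 → V → ℤ} {r ρ : Fin 4 → ℤ} {S : Finset (Fin 4)} {i j : Fin 4} {v : V}

theorem advance_of_mem (hi : i ∈ S) : advance r S i = r i + 1 := if_pos hi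

theorem advance_of_notMem (hi : i ∉ S) : advance r S i = r i := if_neg hi

theorem le_advance : r ≤ advance r S := fun i => by
  by_cases hi : i ∈ S
  · exact (advance_of_mem (r := r) hi).symm ▸ (Int.lt_succ (r i)).le
  · exact (advance_of_notMem hi).ge

theorem advance_mono {T : Finset (Fin 4)} (h : S ⊆ T) : advance r S ≤ advance r T := fun i => by
  by_cases hi : i ∈ S
  · rw [advance_of_mem hi, advance_of_mem (h hi)]
  · rw [advance_of_notMem hi]
    exact le_advance i

theorem advance_advance_singleton (hi : i ∉ S) :
    advance (advance r S) {i} = advance r (insert i S) := by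
  funext j
  by_cases hj : j = i
  · subst hj
    simp [advance, hi]
  · simp [advance, hj]

theorem advance_le_advance (h : r ≤ ρ) : advance r S ≤ advance ρ S := fun i => by
  by_cases hi : i ∈ S
  · simpa only [advance_of_mem hi, add_le_add_iff_right] using h i
  · simpa only [advance_of_notMem hi] using h i

theorem sum_advance : ∑ i, advance r S i = ∑ i, r i + S.card := by
  have h : ∀ i, advance r S i = r i + if i ∈ S then 1 else 0 := fun i => by
    unfold advance; split_ifs <;> simp
  simp [h, Finset.sum_add_distrib]

theorem rect_mono (h : r ≤ ρ) : rect z r ⊆ rect z ρ := fun _ hv i => (hv i).trans (h i)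

theorem side_subset_rect : side z r i ⊆ rect z r := fun _ hv => hv.1

theorem openSide_subset_side : openSide z r i ⊆ side z r i := fun _ hv => hv.1

theorem side_subset_frame : side z r i ⊆ frame z r := fun _ hv => ⟨i, hv⟩

theorem frame_subset_rect : frame z r ⊆ rect z r := fun _ ⟨_, hv⟩ => hv.1

theorem side_mono (h : r ≤ ρ) (hi : ρ i = r i) : side z r i ⊆ side z ρ i :=
  fun _ hv => ⟨rect_mono h hv.1, hv.2.trans hi.symm⟩

theorem mem_front_iff : v ∈ front z r i ↔ z i v = r i + 1 ∧ ∀ j ≠ i, z j v ≤ r j := by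
  have hi : advance r {i} i = r i + 1 := advance_of_mem (Finset.mem_singleton_self i)
  have hne : ∀ j ≠ i, advance r {i} j = r j := fun j hj => advance_of_notMem (by simpa using hj)
  refine ⟨fun hv => ⟨hv.2.trans hi, fun j hj => (hv.1 j).trans_eq (hne j hj)⟩,
    fun hv => ⟨fun j => ?_, hv.1.trans hi.symm⟩⟩
  by_cases hj : j = i
  · rw [hj, hv.1, hi]
  · exact (hv.2 j hj).trans_eq (hne j hj).symm

theorem disjoint_rect_front (h : ρ i = r i) : Disjoint (rect z ρ) (front z r i) :=
  disjoint_left.2 fun v hv hv' => by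
    have := hv i
    have := (mem_front_iff.1 hv').1
    omega

theorem disjoint_front (hij : i ≠ j) : Disjoint (front z r i) (front z r j) :=
  disjoint_left.2 fun v hi hj => by
    have := (mem_front_iff.1 hi).1
    have := (mem_front_iff.1 hj).2 i hij
    omega

theorem disjoint_openSide (hij : i ≠ j) : Disjoint (openSide z r i) (openSide z r j) :=
  disjoint_left.2 fun _ hi hj => hij (hj.2 i hi.1.2)

theorem rect_subset_rect_advance : rect z r ⊆ rect z (advance r S) := rect_mono le_advance

theorem front_subset_rect_advance (hi : i ∈ S) : front z r i ⊆ rect z (advance r S) :=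
  side_subset_rect.trans (rect_mono (advance_mono (Finset.singleton_subset_iff.2 hi)))

theorem front_subset_side (hρ : r ≤ ρ) (hi : ρ i = r i + 1) : front z r i ⊆ side z ρ i :=
  fun v hv => by
    obtain ⟨hvi, hvj⟩ := mem_front_iff.1 hv
    refine ⟨fun j => ?_, hvi.trans hi.symm⟩
    by_cases hj : j = i
    · rw [hj, hvi, hi]
    · exact (hvj j hj).trans (hρ j)

theorem frame_subset_openSide_union : frame z r ⊆ openSide z r i ∪ frame z (advance r {i}) := by
  rintro v ⟨k, hk⟩
  by_cases hj : ∃ j, j ≠ i ∧ z j v = r j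
  · obtain ⟨j, hji, hj⟩ := hj
    exact Or.inr ⟨j, rect_subset_rect_advance hk.1,
      hj.trans (advance_of_notMem (by simpa using hji)).symm⟩
  · have hopen : ∀ j, z j v = r j → j = i := fun j hj' => by_contra fun hji => hj ⟨j, hji, hj'⟩
    exact Or.inl ⟨⟨hk.1, hopen k hk.2 ▸ hk.2⟩, hopen⟩

theorem ncard_inter_frame_le_sum (A : Set V) (z : Fin 4 → V → ℤ) (r : Fin 4 → ℤ) :
    (A ∩ frame z r).ncard ≤ ∑ i, (A ∩ side z r i).ncard := by
  have hunion : A ∩ frame z r = ⋃ i ∈ (Finset.univ : Finset (Fin 4)), A ∩ side z r i := by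
    ext v
    simp [frame]
  rw [hunion]
  exact Finset.set_ncard_biUnion_le _ _

end Geometry

section Directions

theorem forall_direction_iff (i : Fin 4) {p : Fin 4 → Prop} :
    (∀ j, p j) ↔ p i ∧ p (i + 1) ∧ p (i + 2) ∧ p (i + 3) := by
  refine ⟨fun h => ⟨h _, h _, h _, h _⟩, fun ⟨h₀, h₁, h₂, h₃⟩ j => ?_⟩
  have hj : j = i ∨ j = i + 1 ∨ j = i + 2 ∨ j = i + 3 := by omega
  rcases hj with rfl | rfl | rfl | rfl <;> assumption

theorem sum_direction {M : Type*} [AddCommMonoid M] (i : Fin 4) (f : Fin 4 → M) :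
    ∑ j, f j = f i + f (i + 1) + f (i + 2) + f (i + 3) := by
  rw [← Fintype.sum_equiv (Equiv.addLeft i) (fun j => f (i + j)) f fun _ => rfl]
  simp [Fin.sum_univ_four]

theorem compl_adjacent_pair (i : Fin 4) : ({i, i + 1} : Finset (Fin 4))ᶜ = {i + 2, i + 3} := by
  decide +revert

theorem compl_opposite_pair (i : Fin 4) : ({i, i + 2} : Finset (Fin 4))ᶜ = {i + 1, i + 3} := by
  decide +revert

theorem opposite_opposite (i : Fin 4) : i + 2 + 2 = i := by omega

end Directions

section Coordinates

variable {V : Type*} {G : SimpleGraph V} {z : Fin 4 → V → ℤ} {g K c : ℕ}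
  {r : Fin 4 → ℤ} {i j : Fin 4} {A : Set V}

/-- Two integer coordinates on `G`, recorded as four directions `z i`, for which rectangles behave
as in a planar grid: a fire that holds at least `K` vertices of a side advances by `g` more
vertices than it holds on the open side, and a side has about `g / 2` vertices per unit length, up
to an error `c / 2`. -/
structure Coordinates (G : SimpleGraph V) (z : Fin 4 → V → ℤ) (g K c : ℕ) : Prop where
  opposite : ∀ i v, z (i + 2) v = -z i v
  lipschitz : ∀ i u v, G.Adj u v → z i v ≤ z i u + 1
  rect_finite : ∀ r, (rect z r).Finite
  growth : ∀ r i A, (∀ j, 0 < r j + r (j + 2)) → A ⊆ side z r i → K ≤ A.ncard →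
    (A ∩ openSide z r i).ncard + g ≤ (exits G z r i A).ncard
  side_ncard_le : ∀ r i, (∀ j, 0 ≤ r j + r (j + 2)) →
    2 * ((side z r i).ncard : ℤ) ≤ g * (r (i + 1) + r (i + 3)) + c
  le_side_ncard : ∀ r i, (∀ j, 0 ≤ r j + r (j + 2)) →
    g * (r (i + 1) + r (i + 3)) ≤ 2 * ((side z r i).ncard : ℤ)

namespace Coordinates

theorem side_finite (h : Coordinates G z g K c) (r : Fin 4 → ℤ) (i : Fin 4) :
    (side z r i).Finite :=
  (h.rect_finite r).subset side_subset_rect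

theorem openSide_finite (h : Coordinates G z g K c) (r : Fin 4 → ℤ) (i : Fin 4) :
    (openSide z r i).Finite :=
  (h.side_finite r i).subset openSide_subset_side

theorem front_finite (h : Coordinates G z g K c) (r : Fin 4 → ℤ) (i : Fin 4) :
    (front z r i).Finite :=
  h.side_finite _ i

theorem frame_finite (h : Coordinates G z g K c) (r : Fin 4 → ℤ) : (frame z r).Finite :=
  (h.rect_finite r).subset frame_subset_rect

theorem disjoint_side_opposite (h : Coordinates G z g K c) (hr : 0 < r i + r (i + 2)) :
    Disjoint (side z r i) (side z r (i + 2)) :=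
  disjoint_left.2 fun v hv hv' => by
    have := hv.2
    have := hv'.2
    rw [h.opposite] at this
    omega

theorem side_subset_openSide_advance (h : Coordinates G z g K c) (hr : 0 < r i + r (i + 2)) :
    side z r i ⊆ openSide z (advance r {i + 1, i + 3}) i := fun v hv => by
  have hi : advance r {i + 1, i + 3} i = r i := advance_of_notMem (by simp)
  refine ⟨side_mono le_advance hi hv, fun j hj => by_contra fun hji => ?_⟩
  have hcases : j = i + 2 ∨ j = i + 1 ∨ j = i + 3 := by omega
  rcases hcases with rfl | hodd
  · rw [advance_of_notMem (by simp)] at hj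
    exact disjoint_left.1 (h.disjoint_side_opposite hr) hv ⟨hv.1, hj⟩
  · rw [advance_of_mem (by simpa using hodd)] at hj
    have := hv.1 j
    omega

/-- A corner is a side of a rectangle of extent zero. -/
theorem corner_ncard_le (h : Coordinates G z g K c) (hr : ∀ j, 0 ≤ r j + r (j + 2))
    (hij : j = i + 1 ∨ j = i + 3) : 2 * {v | v ∈ side z r i ∧ z j v = r j}.ncard ≤ c := by
  set ρ : Fin 4 → ℤ := Function.update r (j + 2) (-r j) with hρdef
  have hρ : ∀ k, k ≠ j + 2 → ρ k = r k := fun k hk => Function.update_of_ne hk _ _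
  have hρj : ρ (j + 2) = -r j := Function.update_self _ _ _
  have hcorner : {v | v ∈ side z r i ∧ z j v = r j} ⊆ side z ρ i := fun v ⟨hv, hvj⟩ => by
    refine ⟨fun k => ?_, hv.2.trans (hρ i (by omega)).symm⟩
    by_cases hk : k = j + 2
    · rw [hk, hρj, h.opposite, hvj]
    · exact (hv.1 k).trans_eq (hρ k hk).symm
  have hnonneg : ∀ k, 0 ≤ ρ k + ρ (k + 2) := by
    rw [forall_direction_iff j]
    have h₁ := hr (j + 1)
    have h₃ := hr (j + 3)
    have e : j + 3 + 2 = j + 1 := by omega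
    have e' : j + 1 + 2 = j + 3 := by omega
    rw [e, e', opposite_opposite, hρj, hρ j (by omega), hρ (j + 1) (by omega),
      hρ (j + 3) (by omega)]
    rw [e'] at h₁
    omega
  have hzero : ρ (i + 1) + ρ (i + 3) = 0 := by
    have hj : ρ j + ρ (j + 2) = 0 := by rw [hρj, hρ j (by omega)]; omega
    rcases hij with rfl | rfl
    · rwa [show i + 3 = i + 1 + 2 by omega]
    · rwa [show i + 1 = i + 3 + 2 by omega, add_comm]
  have hside := h.side_ncard_le ρ i hnonneg
  rw [hzero, mul_zero, zero_add] at hside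
  have := ncard_le_ncard hcorner (h.side_finite ρ i)
  omega

theorem ncard_inter_side_le (h : Coordinates G z g K c) (hr : ∀ j, 0 < r j + r (j + 2))
    (A : Set V) (i : Fin 4) :
    (A ∩ side z r i).ncard ≤ (A ∩ openSide z r i).ncard + c := by
  set corner : Fin 4 → Set V := fun j => {v | v ∈ side z r i ∧ z j v = r j}
  have hfin : ∀ j, (corner j).Finite := fun j => (h.side_finite r i).subset fun _ hv => hv.1
  have hcover : side z r i ⊆ openSide z r i ∪ (corner (i + 1) ∪ corner (i + 3)) := by
    intro v hv
    by_cases hopen : ∀ j, z j v = r j → j = i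
    · exact Or.inl ⟨hv, hopen⟩
    · push Not at hopen
      obtain ⟨j, hj, hji⟩ := hopen
      have hcases : j = i + 1 ∨ j = i + 2 ∨ j = i + 3 := by omega
      rcases hcases with rfl | rfl | rfl
      · exact Or.inr (Or.inl ⟨hv, hj⟩)
      · exact absurd ⟨hv.1, hj⟩ (disjoint_left.1 (h.disjoint_side_opposite (hr i)) hv)
      · exact Or.inr (Or.inr ⟨hv, hj⟩)
  have hr' : ∀ j, 0 ≤ r j + r (j + 2) := fun j => (hr j).le
  have h₁ := h.corner_ncard_le (i := i) hr' (Or.inl rfl)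
  have h₃ := h.corner_ncard_le (i := i) hr' (Or.inr rfl)
  have hsum := ncard_inter_le_add (A := A) hcover (h.openSide_finite r i)
    ((hfin (i + 1)).union (hfin (i + 3)))
  have hcorners := (ncard_le_ncard (inter_subset_right (s := A))
    ((hfin (i + 1)).union (hfin (i + 3)))).trans (ncard_union_le _ _)
  simp only [corner] at hsum hcorners
  omega

theorem two_mul_ncard_inter_side_le (h : Coordinates G z g K c) (hr : ∀ j, 0 ≤ r j + r (j + 2))
    (A : Set V) (i : Fin 4) :
    2 * ((A ∩ side z r i).ncard : ℤ) ≤ g * (r (i + 1) + r (i + 3)) + c := by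
  have := ncard_le_ncard (inter_subset_right (s := A)) (h.side_finite r i)
  have := h.side_ncard_le r i hr
  omega

theorem le_frame_ncard (h : Coordinates G z g K c) (hr : ∀ j, 0 < r j + r (j + 2)) :
    2 * (g * ∑ i, r i) ≤ 2 * ((frame z r).ncard : ℤ) + 8 * c := by
  have hopen : ∑ i, (openSide z r i).ncard ≤ (frame z r).ncard := by
    simpa only [univ_inter] using sum_ncard_inter_le (A := univ) (Z := frame z r)
      (s := Finset.univ) (X := openSide z r) (fun i _ j _ hij => disjoint_openSide hij)
      (fun i _ => openSide_subset_side.trans side_subset_frame)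
      ((h.frame_finite r).inter_of_right _)
  have hside : ∀ i, g * (r (i + 1) + r (i + 3)) ≤ 2 * ((openSide z r i).ncard : ℤ) + 2 * c := by
    intro i
    have hle := h.le_side_ncard r i fun j => (hr j).le
    have hcorner := h.ncard_inter_side_le hr univ i
    simp only [univ_inter] at hcorner
    omega
  have hsum := Finset.sum_le_sum fun i (_ : i ∈ Finset.univ) => hside i
  simp only [← Finset.mul_sum, Finset.sum_add_distrib, Finset.sum_const, Finset.card_univ,
    Fintype.card_fin] at hsum
  have h₁ : ∑ i, r (i + 1) = ∑ i, r i := Equiv.sum_comp (Equiv.addRight (1 : Fin 4)) r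
  have h₃ : ∑ i, r (i + 3) = ∑ i, r i := Equiv.sum_comp (Equiv.addRight (3 : Fin 4)) r
  push_cast [← Int.ofNat_le] at hopen
  rw [h₁, h₃] at hsum
  simp only [nsmul_eq_mul] at hsum
  push_cast at hsum
  linarith

end Coordinates

end Coordinates

section Turns

variable {V : Type*} {G : SimpleGraph V} {z : Fin 4 → V → ℤ} {g K c : ℕ}
  {B B' : Set V} {F F' : Finset V} {r ρ : Fin 4 → ℤ} {S : Finset (Fin 4)} {i : Fin 4}

/-- The potential of a position with burning set `B` and protected set `F`: the protected vertices
of the rectangle together with the burning vertices on its frame. -/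
noncomputable def weight (z : Fin 4 → V → ℤ) (B : Set V) (F : Finset V) (r : Fin 4 → ℤ) : ℕ :=
  (F ∩ rect z r : Set V).ncard + (B ∩ frame z r).ncard

/-- The potential of a position along the axis `i`: only the burning vertices on the sides `i` and
`i + 2` count, while protected vertices count up to one step beyond the other two sides. -/
noncomputable def stripWeight (z : Fin 4 → V → ℤ) (B : Set V) (F : Finset V) (r : Fin 4 → ℤ)
    (i : Fin 4) : ℕ :=
  (F ∩ rect z (advance r {i + 1, i + 3}) : Set V).ncard + (B ∩ side z r i).ncard +
    (B ∩ side z r (i + 2)).ncard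

/-- The directions in which the fire `B` holds at least `K` vertices of the front. -/
noncomputable def moving (z : Fin 4 → V → ℤ) (K : ℕ) (B : Set V) (r : Fin 4 → ℤ) :
    Finset (Fin 4) :=
  {i | K ≤ (B ∩ front z r i).ncard}

/-- One turn of the game, from the position `B`, `F` to the position `B'`, `F'`, for a fire that
holds at least `K` vertices of every side of the rectangle `r`. -/
structure Turn (G : SimpleGraph V) (z : Fin 4 → V → ℤ) (K : ℕ) (B B' : Set V) (F F' : Finset V)
    (r : Fin 4 → ℤ) : Prop where
  burning_subset : B ⊆ B'
  protected_subset : F ⊆ F'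
  spread : ∀ u ∈ B, ∀ v, G.Adj u v → v ∈ B' ∨ v ∈ F'
  extent_pos : ∀ j, 0 < r j + r (j + 2)
  le_ncard_side : ∀ j, K ≤ (B ∩ side z r j).ncard

namespace Turn

theorem openSide_add_le (ht : Turn G z K B B' F F' r) (h : Coordinates G z g K c) (hρ : r ≤ ρ)
    (hi : ρ i = r i) : (B ∩ openSide z ρ i).ncard + g ≤
      (F' ∩ front z ρ i : Set V).ncard + (B' ∩ front z ρ i).ncard := by
  have hpos : ∀ j, 0 < ρ j + ρ (j + 2) := fun j =>
    (ht.extent_pos j).trans_le (add_le_add (hρ j) (hρ (j + 2)))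
  have hlarge : K ≤ (B ∩ side z ρ i).ncard := (ht.le_ncard_side i).trans
    (ncard_le_ncard (inter_subset_inter_right B (side_mono hρ hi))
      ((h.side_finite ρ i).inter_of_right B))
  have hgrowth := h.growth ρ i (B ∩ side z ρ i) hpos inter_subset_right hlarge
  rw [inter_assoc, inter_eq_right.2 openSide_subset_side] at hgrowth
  refine hgrowth.trans ((ncard_le_ncard ?_ ?_).trans (ncard_union_le _ _))
  · rintro v ⟨hv, u, hu, huv⟩
    exact (ht.spread u hu.1 v huv).elim (fun hB => Or.inr ⟨hB, hv⟩) fun hF => Or.inl ⟨hF, hv⟩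
  · exact ((h.front_finite ρ i).inter_of_right _).union ((h.front_finite ρ i).inter_of_right _)

theorem side_le_of_notMem_moving (ht : Turn G z K B B' F F' r) (h : Coordinates G z g K c)
    (hi : i ∉ moving z K B' r) :
    (B ∩ side z r i).ncard ≤ (F' ∩ front z r i : Set V).ncard + (K + c) := by
  have hheld : (B' ∩ front z r i).ncard < K := by simpa [moving] using hi
  have hopen := ht.openSide_add_le h (ρ := r) (i := i) le_rfl rfl
  have hcorner := h.ncard_inter_side_le ht.extent_pos B i
  omega

theorem openSide_add_le_side (ht : Turn G z K B B' F F' r) (h : Coordinates G z g K c)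
    (hρ : r ≤ ρ) (hi : ρ i = r i) (hS : ρ ≤ advance r S) {Z : Set V}
    (hZ : rect z (advance r S) ⊆ Z) :
    (B ∩ openSide z ρ i).ncard + g * (advance r S i - r i) ≤
      ((F' ∩ (front z ρ i ∩ Z) : Set V).ncard : ℤ) + (B' ∩ side z (advance r S) i).ncard := by
  have hfin := (h.side_finite (advance r S) i).inter_of_right B'
  by_cases hiS : i ∈ S
  · have hadv : advance r S i = ρ i + 1 := by rw [hi, advance_of_mem hiS]
    have hfront := front_subset_side (z := z) hS hadv
    have hB := ncard_le_ncard (inter_subset_inter_right B' hfront) hfin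
    have hopen := ht.openSide_add_le h hρ hi
    rw [inter_eq_left.2 ((hfront.trans side_subset_rect).trans hZ), hadv, hi, add_sub_cancel_left,
      mul_one]
    omega
  · have hadv : advance r S i = r i := advance_of_notMem hiS
    have hB : (B ∩ openSide z ρ i).ncard ≤ (B' ∩ side z (advance r S) i).ncard :=
      ncard_le_ncard (inter_subset_inter ht.burning_subset
        (openSide_subset_side.trans (side_mono hS (hadv.trans hi.symm)))) hfin
    rw [hadv, sub_self, mul_zero]
    omega

theorem weight_add_le (ht : Turn G z K B B' F F' r) (h : Coordinates G z g K c) (hρ : r ≤ ρ)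
    (hi : ρ i = r i) {M : Set V} (hB' : B' ∩ front z ρ i ⊆ M) (hB : M ∩ openSide z ρ i ⊆ B) :
    weight z M F' ρ + g ≤ weight z M F' (advance ρ {i}) := by
  have hopen := ht.openSide_add_le h hρ hi
  have hself : i ∈ ({i} : Finset (Fin 4)) := Finset.mem_singleton_self i
  have hF := ncard_inter_add_le (A := (F' : Set V)) (disjoint_rect_front (z := z) (r := ρ) rfl)
    rect_subset_rect_advance (front_subset_rect_advance hself)
    ((h.rect_finite (advance ρ {i})).inter_of_right _)
  have hlost := ncard_le_ncard (subset_inter hB inter_subset_right)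
    ((h.openSide_finite ρ i).inter_of_right B)
  have hgained := ncard_le_ncard (subset_inter hB' inter_subset_right)
    ((h.front_finite ρ i).inter_of_right M)
  have hsplit : (M ∩ frame z ρ).ncard ≤ (M ∩ openSide z ρ i).ncard +
      (M ∩ (frame z (advance ρ {i}) \ front z ρ i)).ncard := by
    refine ncard_inter_le_add (fun v hv => ?_) (h.openSide_finite ρ i)
      ((h.frame_finite _).subset sdiff_subset)
    exact (frame_subset_openSide_union hv).imp_right fun hv' =>
      ⟨hv', disjoint_left.1 (disjoint_rect_front rfl) (frame_subset_rect hv)⟩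
  have hjoin := ncard_inter_add_le (A := M) (X := frame z (advance ρ {i}) \ front z ρ i)
    (Y := front z ρ i) disjoint_sdiff_left sdiff_subset side_subset_frame
    ((h.frame_finite (advance ρ {i})).inter_of_right M)
  unfold weight
  omega

end Turn

theorem weight_mono (h : Coordinates G z g K c) (hB : B ⊆ B') (hF : F ⊆ F') :
    weight z B F r ≤ weight z B' F' r :=
  add_le_add
    (ncard_le_ncard (inter_subset_inter_left _ (Finset.coe_subset.2 hF))
      ((h.rect_finite r).inter_of_right _))
    (ncard_le_ncard (inter_subset_inter_left _ hB) ((h.frame_finite r).inter_of_right _))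

namespace Turn

/-- The sides advance one at a time; meanwhile the burning set is frozen at
`B ∪ (B' \ rect z r)`, which contains the new fronts but nothing new on the sides left behind. -/
theorem weight_advance (ht : Turn G z K B B' F F' r) (h : Coordinates G z g K c)
    (S : Finset (Fin 4)) :
    weight z B F r + g * S.card ≤ weight z B' F' (advance r S) := by
  set M : Set V := B ∪ (B' \ rect z r)
  suffices hMS : weight z M F' r + g * S.card ≤ weight z M F' (advance r S) by
    have hstart : weight z B F r ≤ weight z M F' r :=
      weight_mono h subset_union_left ht.protected_subset
    have hend : weight z M F' (advance r S) ≤ weight z B' F' (advance r S) :=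
      weight_mono h (union_subset ht.burning_subset sdiff_subset) le_rfl
    omega
  induction S using Finset.induction with
  | empty => simp [show advance r ∅ = r from funext fun _ => rfl]
  | insert i S hi ih =>
    have hρi : advance r S i = r i := advance_of_notMem hi
    have hfront : B' ∩ front z (advance r S) i ⊆ M := fun v hv =>
      Or.inr ⟨hv.1, fun hr => disjoint_left.1 (disjoint_rect_front hρi.symm) hr hv.2⟩
    have hopen : M ∩ openSide z (advance r S) i ⊆ B := by
      rintro v ⟨hB | ⟨-, hout⟩, hv⟩
      · exact hB
      · refine absurd (fun j => ?_) hout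
        have hj := hv.1.1 j
        by_cases hjS : j ∈ S
        · have hne := mt (hv.2 j) (ne_of_mem_of_not_mem hjS hi)
          rw [advance_of_mem hjS] at hj hne
          omega
        · rwa [advance_of_notMem hjS] at hj
    have hstep := ht.weight_add_le h le_advance hρi hfront hopen
    rw [advance_advance_singleton hi] at hstep
    rw [Finset.card_insert_of_notMem hi, mul_add_one]
    omega

theorem ncard_rect_add_sum_front_le (ht : Turn G z K B B' F F' r) {H : Finset (Fin 4)}
    {q : Fin 4 → ℤ} (hρ : ∀ i ∈ H, ρ i = q i) {Z : Set V} (hZ : rect z ρ ⊆ Z) :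
    (F ∩ rect z ρ : Set V).ncard + ∑ i ∈ H, (F' ∩ (front z q i ∩ Z) : Set V).ncard ≤
      (F' ∩ Z : Set V).ncard := by
  have hinside := ncard_le_ncard (inter_subset_inter_left (rect z ρ)
    (Finset.coe_subset.2 ht.protected_subset)) (F'.finite_toSet.inter_of_left _)
  have houtside : ∑ i ∈ H, (F' ∩ (front z q i ∩ Z) : Set V).ncard ≤
      (F' ∩ (Z \ rect z ρ) : Set V).ncard :=
    sum_ncard_inter_le
      (fun i _ j _ hij => (disjoint_front hij).mono inter_subset_left inter_subset_left)
      (fun i hi v hv => ⟨hv.2, disjoint_right.1 (disjoint_rect_front (hρ i hi)) hv.1⟩)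
      (F'.finite_toSet.inter_of_left _)
  have hsplit := ncard_inter_add_le (A := (F' : Set V)) (X := rect z ρ) (Y := Z \ rect z ρ)
    disjoint_sdiff_right hZ sdiff_subset (F'.finite_toSet.inter_of_left _)
  omega

theorem weight_le_of_disjoint_moving (ht : Turn G z K B B' F F' r) (h : Coordinates G z g K c)
    {H : Finset (Fin 4)} (hH : Disjoint H (moving z K B' r)) :
    weight z B F r ≤ F'.card + H.card * (K + c) + ∑ i ∈ Hᶜ, (B ∩ side z r i).ncard := by
  have hheld : ∑ i ∈ H, (B ∩ side z r i).ncard ≤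
      ∑ i ∈ H, (F' ∩ front z r i : Set V).ncard + H.card * (K + c) := by
    rw [← smul_eq_mul, ← Finset.sum_const, ← Finset.sum_add_distrib]
    exact Finset.sum_le_sum fun i hi =>
      ht.side_le_of_notMem_moving h (Finset.disjoint_left.1 hH hi)
  have hF := ht.ncard_rect_add_sum_front_le (z := z) (ρ := r) (q := r) (H := H) (fun _ _ => rfl)
    (subset_univ _)
  simp only [inter_univ, ncard_coe_finset] at hF
  have hframe := ncard_inter_frame_le_sum B z r
  rw [← Finset.sum_add_sum_compl H] at hframe
  unfold weight
  omega

theorem two_mul_weight_le_of_adjacent (ht : Turn G z K B B' F F' r) (h : Coordinates G z g K c)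
    (hi : i ∉ moving z K B' r) (hi' : i + 1 ∉ moving z K B' r) :
    2 * (weight z B F r : ℤ) ≤ 2 * F'.card + 4 * K + 6 * c + g * ∑ j, r j := by
  have hH : Disjoint {i, i + 1} (moving z K B' r) := by simp [hi, hi']
  have hcard : ({i, i + 1} : Finset (Fin 4)).card = 2 := Finset.card_pair (by omega)
  have hweight := ht.weight_le_of_disjoint_moving h hH
  rw [compl_adjacent_pair, hcard, Finset.sum_pair (by omega)] at hweight
  have h₂ := h.two_mul_ncard_inter_side_le (fun j => (ht.extent_pos j).le) B (i + 2)
  have h₃ := h.two_mul_ncard_inter_side_le (fun j => (ht.extent_pos j).le) B (i + 3)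
  rw [show i + 2 + 1 = i + 3 by omega, show i + 2 + 3 = i + 1 by omega] at h₂
  rw [show i + 3 + 1 = i by omega, show i + 3 + 3 = i + 2 by omega] at h₃
  push_cast [sum_direction i, ← Int.ofNat_le] at hweight ⊢
  linarith

theorem two_mul_weight_le_of_opposite (ht : Turn G z K B B' F F' r) (h : Coordinates G z g K c)
    (hi : i ∉ moving z K B' r) (hi' : i + 2 ∉ moving z K B' r) :
    2 * (weight z B F r : ℤ) ≤ 2 * F'.card + 4 * K + 6 * c + 2 * (g * (r i + r (i + 2))) := by
  have hH : Disjoint {i, i + 2} (moving z K B' r) := by simp [hi, hi']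
  have hcard : ({i, i + 2} : Finset (Fin 4)).card = 2 := Finset.card_pair (by omega)
  have hweight := ht.weight_le_of_disjoint_moving h hH
  rw [compl_opposite_pair, hcard, Finset.sum_pair (by omega)] at hweight
  have h₁ := h.two_mul_ncard_inter_side_le (fun j => (ht.extent_pos j).le) B (i + 1)
  have h₃ := h.two_mul_ncard_inter_side_le (fun j => (ht.extent_pos j).le) B (i + 3)
  rw [show i + 1 + 1 = i + 2 by omega, show i + 1 + 3 = i by omega] at h₁
  rw [show i + 3 + 1 = i by omega, show i + 3 + 3 = i + 2 by omega] at h₃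
  push_cast [← Int.ofNat_le] at hweight
  linarith

theorem weight_le_stripWeight (ht : Turn G z K B B' F F' r) (h : Coordinates G z g K c)
    (hi : i + 1 ∉ moving z K B' r) :
    2 * (weight z B F r : ℤ) +
        2 * (g * (advance r S i + advance r S (i + 2) - (r i + r (i + 2)))) ≤
      2 * stripWeight z B' F' (advance r S) i + g * (r i + r (i + 2)) + 2 * K + 7 * c := by
  set Z := rect z (advance (advance r S) {i + 1, i + 3})
  have hSZ : rect z (advance r S) ⊆ Z := rect_subset_rect_advance
  have hF := ht.ncard_rect_add_sum_front_le (z := z) (ρ := r) (q := r) (H := {i, i + 1, i + 2})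
    (fun _ _ => rfl) (rect_subset_rect_advance.trans hSZ)
  have hfront : front z r (i + 1) ⊆ Z := side_subset_rect.trans
    (rect_mono ((advance_le_advance le_advance).trans (advance_mono (by simp))))
  rw [Finset.sum_insert (by simp), Finset.sum_pair (by omega), inter_eq_left.2 hfront] at hF
  have h₀ := ht.openSide_add_le_side (i := i) h le_rfl rfl le_advance hSZ
  have h₂ := ht.openSide_add_le_side (i := i + 2) h le_rfl rfl le_advance hSZ
  have hc₀ := h.ncard_inter_side_le ht.extent_pos B i
  have hc₂ := h.ncard_inter_side_le ht.extent_pos B (i + 2)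
  have h₁ := ht.side_le_of_notMem_moving h hi
  have h₃ := h.two_mul_ncard_inter_side_le (fun j => (ht.extent_pos j).le) B (i + 3)
  rw [show i + 3 + 1 = i by omega, show i + 3 + 3 = i + 2 by omega] at h₃
  have hframe := ncard_inter_frame_le_sum B z r
  rw [sum_direction i] at hframe
  unfold weight stripWeight
  push_cast [← Int.ofNat_le] at hF hframe hc₀ hc₂ h₁ ⊢
  linarith

theorem stripWeight_add_le (ht : Turn G z K B B' F F' r) (h : Coordinates G z g K c)
    (hS : {i + 1, i + 3} ⊆ S) :
    stripWeight z B F r i + g * (advance r S i + advance r S (i + 2) - (r i + r (i + 2))) ≤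
      (stripWeight z B' F' (advance r S) i : ℤ) := by
  set ρ := advance r {i + 1, i + 3}
  set Z := rect z (advance (advance r S) {i + 1, i + 3})
  have hSZ : rect z (advance r S) ⊆ Z := rect_subset_rect_advance
  have hρ : ρ i = r i := advance_of_notMem (by simp)
  have hρ' : ρ (i + 2) = r (i + 2) := advance_of_notMem (by simp)
  have hF := ht.ncard_rect_add_sum_front_le (z := z) (ρ := ρ) (q := ρ) (H := {i, i + 2})
    (fun _ _ => rfl) ((rect_mono (advance_mono hS)).trans hSZ)
  rw [Finset.sum_pair (by omega)] at hF
  have h₀ := ht.openSide_add_le_side h le_advance hρ (advance_mono hS) hSZ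
  have h₂ := ht.openSide_add_le_side h le_advance hρ' (advance_mono hS) hSZ
  have hB₀ := ncard_le_ncard
    (inter_subset_inter_right B (h.side_subset_openSide_advance (ht.extent_pos i)))
    ((h.openSide_finite _ i).inter_of_right B)
  have hB₂ := ncard_le_ncard
    (inter_subset_inter_right B (h.side_subset_openSide_advance (ht.extent_pos (i + 2))))
    ((h.openSide_finite _ (i + 2)).inter_of_right B)
  rw [show i + 2 + 1 = i + 3 by omega, show i + 2 + 3 = i + 1 by omega,
    Finset.pair_comm] at hB₂
  unfold stripWeight
  push_cast [← Int.ofNat_le] at hF hB₀ hB₂ ⊢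
  linarith

theorem stripWeight_le_card (ht : Turn G z K B B' F F' r) (h : Coordinates G z g K c)
    (hi : i ∉ moving z K B' r) (hi' : i + 2 ∉ moving z K B' r) :
    stripWeight z B F r i ≤ F'.card + 2 * K + 2 * c := by
  have hρ : ∀ j ∈ ({i, i + 2} : Finset (Fin 4)), advance r {i + 1, i + 3} j = r j := fun j hj =>
    advance_of_notMem (by rwa [← compl_opposite_pair, Finset.mem_compl, not_not])
  have hF := ht.ncard_rect_add_sum_front_le (z := z) hρ (subset_univ _)
  rw [Finset.sum_pair (by omega)] at hF
  simp only [inter_univ, ncard_coe_finset] at hF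
  have h₀ := ht.side_le_of_notMem_moving h hi
  have h₂ := ht.side_le_of_notMem_moving h hi'
  unfold stripWeight
  omega

end Turn

end Turns

section LowerBound

variable {V : Type*} {G : SimpleGraph V} {z : Fin 4 → V → ℤ} {B : ℕ → Set V} {F : ℕ → Finset V}
  {r : ℕ → Fin 4 → ℤ} {S : ℕ → Finset (Fin 4)} {g K c N : ℕ}

theorem mem_of_three_le_card {S : Finset (Fin 4)} (hS : 3 ≤ S.card) {i j : Fin 4} (hij : i ≠ j)
    (hi : i ∉ S) : j ∈ S := by
  by_contra hj
  have hdisj : Disjoint S {i, j} := by simp [hi, hj]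
  have hcard := Finset.card_le_univ (S ∪ {i, j})
  rw [Finset.card_union_of_disjoint hdisj, Finset.card_pair hij, Fintype.card_fin] at hcard
  omega

/-- A game whose initial fire is a large square of radius `N`, against protection at the rate
`3 * g / 2`. The rectangle `r t` follows the fire: in turn `t + 1` it advances in the directions
`S t` in which the fire has captured enough of the front. -/
structure LargeRun (G : SimpleGraph V) (z : Fin 4 → V → ℤ) (B : ℕ → Set V) (F : ℕ → Finset V)
    (r : ℕ → Fin 4 → ℤ) (S : ℕ → Finset (Fin 4)) (g K c N : ℕ) : Prop where
  coords : Coordinates G z g K c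
  start : r 0 = fun _ => (N : ℤ)
  moving_eq : ∀ t, moving z K (B (t + 1)) (r t) = S t
  step : ∀ t, r (t + 1) = advance (r t) (S t)
  turn : ∀ t, Turn G z K (B t) (B (t + 1)) (F t) (F (t + 1)) (r t)
  weight_zero : 8 * (g * N : ℤ) ≤ 2 * weight z (B 0) (F 0) (r 0) + 8 * c
  budget : ∀ t : ℕ, 2 * ((F (t + 1)).card : ℤ) ≤ 3 * (g * (t + 1))
  large : 10 * (g + K + c : ℤ) < g * N

namespace LargeRun

theorem step_of_mem (h : LargeRun G z B F r S g K c N) {t : ℕ} {i : Fin 4} (hi : i ∈ S t) :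
    r (t + 1) i = r t i + 1 := by
  rw [h.step, advance_of_mem hi]

theorem step_of_notMem (h : LargeRun G z B F r S g K c N) {t : ℕ} {i : Fin 4} (hi : i ∉ S t) :
    r (t + 1) i = r t i := by
  rw [h.step, advance_of_notMem hi]

theorem sum_zero (h : LargeRun G z B F r S g K c N) : ∑ i, r 0 i = 4 * (N : ℤ) := by
  simp [h.start]

theorem sum_succ (h : LargeRun G z B F r S g K c N) (t : ℕ) :
    ∑ i, r (t + 1) i = ∑ i, r t i + (S t).card := by
  rw [h.step, sum_advance]

theorem le_two_mul_weight (h : LargeRun G z B F r S g K c N) (t : ℕ) :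
    2 * (g * ∑ i, r t i) ≤ 2 * (weight z (B t) (F t) (r t) : ℤ) + 8 * c := by
  induction t with
  | zero =>
    have := h.weight_zero
    rw [h.sum_zero]
    linarith
  | succ t ih =>
    have hstep := (h.turn t).weight_advance h.coords (S t)
    rw [← h.step] at hstep
    push_cast [← Int.ofNat_le] at hstep
    rw [h.sum_succ]
    linarith

theorem extent_succ_of_three_le (h : LargeRun G z B F r S g K c N) {t : ℕ}
    (ht : 3 ≤ (S t).card) (i : Fin 4) :
    r t i + r t (i + 2) + 1 ≤ r (t + 1) i + r (t + 1) (i + 2) := by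
  have hle : ∀ j, r t j ≤ r (t + 1) j := by
    rw [h.step]
    exact le_advance
  by_cases hi : i ∈ S t
  · have := hle (i + 2)
    have := h.step_of_mem hi
    omega
  · have := hle i
    have := h.step_of_mem (mem_of_three_le_card ht (j := i + 2) (by omega) hi)
    omega

theorem extent_ge (h : LargeRun G z B F r S g K c N) {T : ℕ} (hfast : ∀ t < T, 3 ≤ (S t).card)
    (i : Fin 4) : 2 * (N : ℤ) + T ≤ r T i + r T (i + 2) := by
  induction T with
  | zero => simp [h.start, two_mul]
  | succ T ih =>
    have hprev := ih fun t ht => hfast t (by omega)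
    have hstep := h.extent_succ_of_three_le (hfast T (by omega)) i
    push_cast
    omega

theorem sum_ge (h : LargeRun G z B F r S g K c N) {T : ℕ} (hfast : ∀ t < T, 3 ≤ (S t).card) :
    4 * (N : ℤ) + 3 * T ≤ ∑ i, r T i := by
  induction T with
  | zero => simp [h.sum_zero]
  | succ T ih =>
    have hprev := ih fun t ht => hfast t (by omega)
    have hstep := hfast T (by omega)
    rw [h.sum_succ]
    push_cast
    omega

theorem not_adjacent (h : LargeRun G z B F r S g K c N) {T : ℕ}
    (hfast : ∀ t < T, 3 ≤ (S t).card) {i : Fin 4} (hi : i ∉ S T) : i + 1 ∈ S T := by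
  by_contra hi'
  rw [← h.moving_eq] at hi hi'
  have hupper := (h.turn T).two_mul_weight_le_of_adjacent h.coords hi hi'
  have hlower := h.le_two_mul_weight T
  have hperimeter := mul_le_mul_of_nonneg_left (h.sum_ge hfast) (Int.natCast_nonneg g)
  have hbudget := h.budget T
  have hlarge := h.large
  linarith

theorem two_mul_extent_le_of_opposite (h : LargeRun G z B F r S g K c N) {T : ℕ} {i : Fin 4}
    (hi : i ∉ S T) (hi' : i + 2 ∉ S T) :
    2 * (g * (r T (i + 1) + r T (i + 3))) ≤ 3 * (g * (T + 1)) + 4 * K + 14 * (c : ℤ) := by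
  rw [← h.moving_eq] at hi hi'
  have hupper := (h.turn T).two_mul_weight_le_of_opposite h.coords hi hi'
  have hlower := h.le_two_mul_weight T
  rw [sum_direction i] at hlower
  have hbudget := h.budget T
  linarith

theorem stripWeight_mono (h : LargeRun G z B F r S g K c N) {s T : ℕ} (hsT : s ≤ T) {i : Fin 4}
    (hS : ∀ t, s ≤ t → t < T → {i + 1, i + 3} ⊆ S t) :
    stripWeight z (B s) (F s) (r s) i + g * (r T i + r T (i + 2) - (r s i + r s (i + 2))) ≤
      (stripWeight z (B T) (F T) (r T) i : ℤ) := by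
  induction T, hsT using Nat.le_induction with
  | base => simp
  | succ T hsT ih =>
    have hprev := ih fun t hst htT => hS t hst (by omega)
    have hstep := (h.turn T).stripWeight_add_le h.coords (hS T hsT (by omega))
    rw [← h.step] at hstep
    linarith

theorem transverse_extent_eq (h : LargeRun G z B F r S g K c N) {s T : ℕ} (hsT : s ≤ T)
    {i : Fin 4} (hS : ∀ t, s ≤ t → t < T → {i + 1, i + 3} ⊆ S t) :
    r T (i + 1) + r T (i + 3) = r s (i + 1) + r s (i + 3) + 2 * ((T : ℤ) - s) := by
  induction T, hsT using Nat.le_induction with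
  | base => simp
  | succ T hsT ih =>
    have hprev := ih fun t hst htT => hS t hst (by omega)
    have hT := hS T hsT (by omega)
    rw [h.step_of_mem (hT (by simp)), h.step_of_mem (hT (by simp))]
    push_cast
    omega

theorem extent_mono (h : LargeRun G z B F r S g K c N) {s T : ℕ} (hsT : s ≤ T)
    (hfast : ∀ t < T, 3 ≤ (S t).card) (i : Fin 4) :
    r s i + r s (i + 2) + ((T : ℤ) - s) ≤ r T i + r T (i + 2) := by
  induction T, hsT using Nat.le_induction with
  | base => simp
  | succ T _ ih =>
    have hprev := ih fun t ht => hfast t (by omega)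
    have hstep := h.extent_succ_of_three_le (hfast T (by omega)) i
    push_cast
    omega

/-- Averages two lower bounds on the number of protected vertices: the one that `weight` gives for
turn `T + 1`, and the one that `stripWeight` gives from turn `s + 1` on, when the side `i + 1` was
held for the last time. -/
theorem not_opposite_of_held (h : LargeRun G z B F r S g K c N) {s T : ℕ} (hsT : s < T)
    (hfast : ∀ t < T, 3 ≤ (S t).card) {i : Fin 4} (hs : i + 1 ∉ S s)
    (hS : ∀ t, s + 1 ≤ t → t < T → {i + 1, i + 3} ⊆ S t) (hi : i ∉ S T) : i + 2 ∈ S T := by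
  by_contra hi'
  have hopposite := h.two_mul_extent_le_of_opposite hi hi'
  have hfast' : ∀ t < s, 3 ≤ (S t).card := fun t ht => hfast t (by omega)
  have hS' : ∀ j, i + 1 ≠ j → r (s + 1) j = r s j + 1 := fun j hj =>
    h.step_of_mem (mem_of_three_le_card (hfast s hsT) hj hs)
  have hwidth := h.extent_mono hsT hfast i
  have hheight := h.transverse_extent_eq hsT hS
  have hstrip := h.stripWeight_mono hsT hS
  rw [h.step_of_notMem hs, hS' (i + 3) (by omega)] at hheight
  rw [hS' i (by omega), hS' (i + 2) (by omega)] at hwidth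
  have hstart := (h.turn s).weight_le_stripWeight (S := S s) h.coords (h.moving_eq s ▸ hs)
  rw [← h.step] at hstart
  have hend := (h.turn T).stripWeight_le_card h.coords (h.moving_eq T ▸ hi) (h.moving_eq T ▸ hi')
  have hweight := h.le_two_mul_weight s
  have hbudget := h.budget T
  have hheight_ge := h.extent_ge hfast' (i + 1)
  rw [show i + 1 + 2 = i + 3 by omega] at hheight_ge
  have hsum_ge := h.sum_ge hfast'
  rw [sum_direction i] at hweight hsum_ge
  push_cast [← Int.ofNat_le] at hend hwidth hheight
  have hgeometry : 10 * (N : ℤ) + 6 * T ≤ 2 * (r T (i + 1) + r T (i + 3)) +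
      2 * (r s (i + 1) + r s (i + 3)) + (r s i + r s (i + 2)) +
      2 * (r T i + r T (i + 2) - (r s i + r s (i + 2))) := by omega
  have hscaled := mul_le_mul_of_nonneg_left hgeometry (Int.natCast_nonneg g)
  have hlarge := h.large
  linarith

theorem not_opposite (h : LargeRun G z B F r S g K c N) {T : ℕ}
    (hfast : ∀ t < T, 3 ≤ (S t).card) {i : Fin 4} (hi : i ∉ S T) : i + 2 ∈ S T := by
  by_contra hi'
  by_cases hall : ∀ t < T, {i + 1, i + 3} ⊆ S t
  · have hopposite := h.two_mul_extent_le_of_opposite hi hi'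
    have hheight := h.transverse_extent_eq T.zero_le fun t _ => hall t
    have hlarge := h.large
    simp only [h.start, Nat.cast_zero, sub_zero] at hheight
    rw [hheight] at hopposite
    have : (0 : ℤ) ≤ g * T := by positivity
    linarith
  · push Not at hall
    obtain ⟨t₀, ht₀, hheld₀⟩ := hall
    set s := Nat.findGreatest (fun t => t < T ∧ ¬ {i + 1, i + 3} ⊆ S t) T
    obtain ⟨hsT, hheld⟩ : s < T ∧ ¬ {i + 1, i + 3} ⊆ S s :=
      Nat.findGreatest_spec (P := fun t => t < T ∧ ¬ {i + 1, i + 3} ⊆ S t) ht₀.le ⟨ht₀, hheld₀⟩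
    have hlast : ∀ t, s + 1 ≤ t → t < T → {i + 1, i + 3} ⊆ S t := fun t hst htT =>
      not_not.1 fun hS => Nat.findGreatest_is_greatest hst htT.le ⟨htT, hS⟩
    by_cases h₁ : i + 1 ∈ S s
    · have h₃ : i + 3 ∉ S s := fun h₃ =>
        hheld (Finset.insert_subset h₁ (Finset.singleton_subset_iff.2 h₃))
      have e₁ : i + 2 + 1 = i + 3 := by omega
      have e₃ : i + 2 + 3 = i + 1 := by omega
      refine hi (opposite_opposite i ▸ h.not_opposite_of_held (i := i + 2) hsT hfast ?_ ?_ hi')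
      · rwa [e₁]
      · rwa [e₁, e₃, Finset.pair_comm]
    · exact hi' (h.not_opposite_of_held hsT hfast h₁ hlast hi)

theorem three_le_card (h : LargeRun G z B F r S g K c N) (T : ℕ) : 3 ≤ (S T).card := by
  induction T using Nat.strong_induction_on with
  | _ T ih =>
  by_contra hT
  have hcompl : 1 < (S T)ᶜ.card := by
    rw [Finset.card_compl, Fintype.card_fin]
    omega
  obtain ⟨i, hi, j, hj, hij⟩ := Finset.one_lt_card.1 hcompl
  rw [Finset.mem_compl] at hi hj
  have hcases : j = i + 1 ∨ j = i + 2 ∨ i = j + 1 := by omega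
  rcases hcases with rfl | rfl | rfl
  · exact hj (h.not_adjacent ih hi)
  · exact hj (h.not_opposite ih hi)
  · exact hi (h.not_adjacent ih hj)

end LargeRun

theorem Turn.le_ncard_side_advance {B B' : Set V} {F F' : Finset V} {r : Fin 4 → ℤ}
    (ht : Turn G z K B B' F F' r) (h : Coordinates G z g K c) (i : Fin 4) :
    K ≤ (B' ∩ side z (advance r (moving z K B' r)) i).ncard := by
  have hfin := (h.side_finite (advance r (moving z K B' r)) i).inter_of_right B'
  by_cases hi : i ∈ moving z K B' r
  · have hfront : K ≤ (B' ∩ front z r i).ncard := by simpa [moving] using hi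
    exact hfront.trans (ncard_le_ncard (inter_subset_inter_right B'
      (front_subset_side le_advance (advance_of_mem hi))) hfin)
  · exact (ht.le_ncard_side i).trans (ncard_le_ncard (inter_subset_inter ht.burning_subset
      (side_mono le_advance (advance_of_notMem hi))) hfin)

theorem burning_mono (G : SimpleGraph V) (B₀ : Set V) (F : ℕ → Finset V) :
    Monotone (burning G B₀ F) :=
  monotone_nat_of_le_succ fun _ => subset_union_left

theorem mem_of_adj_burning {B₀ : Set V} {t : ℕ} {u v : V} (hu : u ∈ burning G B₀ F t)
    (huv : G.Adj u v) : v ∈ burning G B₀ F (t + 1) ∨ v ∈ F (t + 1) := by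
  by_cases hv : v ∈ F (t + 1)
  · exact Or.inr hv
  · exact Or.inl (Or.inr ⟨hv, u, hu, huv⟩)

theorem IsLegalPlay.turn {B₀ : Set V} {f : ℕ → ℝ} (hF : IsLegalPlay G B₀ f F) {t : ℕ}
    {r : Fin 4 → ℤ} (hr : ∀ j, 0 < r j + r (j + 2))
    (hK : ∀ j, K ≤ (burning G B₀ F t ∩ side z r j).ncard) :
    Turn G z K (burning G B₀ F t) (burning G B₀ F (t + 1)) (F t) (F (t + 1)) r where
  burning_subset := subset_union_left
  protected_subset := hF.mono t.le_succ
  spread _ hu _ huv := mem_of_adj_burning hu huv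
  extent_pos := hr
  le_ncard_side := hK

/-- The rectangle that starts as a square of radius `N` and advances in every direction in which
the fire `B` has captured `K` vertices of the front. -/
noncomputable def trackingRect (z : Fin 4 → V → ℤ) (B : ℕ → Set V) (K N : ℕ) : ℕ → Fin 4 → ℤ
  | 0 => fun _ => N
  | t + 1 => advance (trackingRect z B K N t) (moving z K (B (t + 1)) (trackingRect z B K N t))

namespace Coordinates

theorem burning_subset_rect (h : Coordinates G z g K c) {B₀ : Set V} {N : ℤ}
    (hB₀ : B₀ ⊆ rect z fun _ => N) (F : ℕ → Finset V) (t : ℕ) :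
    burning G B₀ F t ⊆ rect z fun _ => N + t := by
  induction t with
  | zero => simpa [burning] using hB₀
  | succ t ih =>
    rintro v (hv | ⟨-, u, hu, huv⟩) i
    · exact (ih hv i).trans (by simp)
    · have hstep := (h.lipschitz i u v huv).trans (add_le_add_left (ih hu i) 1)
      exact hstep.trans_eq (by push_cast; ring)

theorem turn_trackingRect (h : Coordinates G z g K c) (hN : 0 < N) (hKN : K ≤ g * N) {f : ℕ → ℝ}
    (hF : IsLegalPlay G (rect z fun _ => N) f F) (t : ℕ) :
    Turn G z K (burning G (rect z fun _ => N) F t) (burning G (rect z fun _ => N) F (t + 1))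
      (F t) (F (t + 1)) (trackingRect z (burning G (rect z fun _ => N) F) K N t) := by
  induction t with
  | zero =>
    refine hF.turn (fun j => by simp only [trackingRect]; omega) fun j => ?_
    have hside := h.le_side_ncard (fun _ => N) j fun _ => by positivity
    simp only [burning, trackingRect, inter_eq_right.2 (side_subset_rect (z := z))]
    zify at hKN ⊢
    linarith
  | succ t ih =>
    exact hF.turn (fun j => (ih.extent_pos j).trans_le (add_le_add (le_advance j)
      (le_advance (j + 2)))) (ih.le_ncard_side_advance h)

theorem largeRun (h : Coordinates G z g K c) (hN : 10 * (g + K + c) < g * N)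
    (hF : IsLegalPlay G (rect z fun _ => N) (fun t => 3 / 2 * (g : ℝ) * t) F) :
    LargeRun G z (burning G (rect z fun _ => N) F) F
      (trackingRect z (burning G (rect z fun _ => N) F) K N)
      (fun t => moving z K (burning G (rect z fun _ => N) F (t + 1))
        (trackingRect z (burning G (rect z fun _ => N) F) K N t)) g K c N where
  coords := h
  start := rfl
  moving_eq _ := rfl
  step _ := rfl
  turn := h.turn_trackingRect (Nat.pos_of_mul_pos_left (by omega : 0 < g * N)) (by omega) hF
  weight_zero := by
    have hN₀ : 0 < N := Nat.pos_of_mul_pos_left (by omega : 0 < g * N)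
    have hframe := h.le_frame_ncard (r := fun _ => (N : ℤ)) fun _ => by omega
    simp only [weight, burning, trackingRect, inter_eq_right.2 (frame_subset_rect (z := z)),
      Finset.sum_const, Finset.card_univ, Fintype.card_fin] at hframe ⊢
    push_cast at hframe ⊢
    have := Int.natCast_nonneg (F 0 ∩ rect z fun _ => (N : ℤ) : Set V).ncard
    simp only [nsmul_eq_mul] at hframe
    push_cast at hframe
    linarith
  budget t := by
    have hbudget := hF.budget (t + 1) (by omega)
    push_cast at hbudget
    have : (2 * ((F (t + 1)).card : ℝ)) ≤ 3 * (g * (t + 1)) := by linarith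
    exact_mod_cast this
  large := by exact_mod_cast hN

theorem exists_not_containable (h : Coordinates G z g K c) (hg : 1 ≤ g) (hK : 1 ≤ K) :
    ∃ B₀ : Set V, B₀.Finite ∧ ¬ Containable G (fun t => 3 / 2 * (g : ℝ) * t) B₀ := by
  obtain ⟨N, hN⟩ : ∃ N, 10 * (g + K + c) < g * N := ⟨10 * (1 + K + c) + 1, by nlinarith⟩
  refine ⟨rect z fun _ => N, h.rect_finite _, ?_⟩
  rintro ⟨F, hF, T, hT⟩
  have hrun := h.largeRun hN hF
  set r := trackingRect z (burning G (rect z fun _ => N) F) K N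
  have hbounded : ∀ t i, r t i ≤ N + T := by
    intro t i
    obtain ⟨v, hv, hvi⟩ := nonempty_of_ncard_ne_zero
      (Nat.one_le_iff_ne_zero.1 (hK.trans ((hrun.turn t).le_ncard_side i)))
    have hvT : v ∈ burning G (rect z fun _ => N) F T := by
      rcases le_total T t with htT | htT
      · exact (hT t htT).subset hv
      · exact burning_mono _ _ _ htT hv
    have := h.burning_subset_rect subset_rfl F T hvT i
    rwa [hvi.2] at this
  have hperimeter := hrun.sum_ge (T := 2 * T + 1) fun t _ => hrun.three_le_card t
  have hsum := Finset.sum_le_sum fun i (_ : i ∈ Finset.univ) => hbounded (2 * T + 1) i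
  simp only [Finset.sum_const, Finset.card_univ, Fintype.card_fin, nsmul_eq_mul] at hsum
  push_cast at hperimeter hsum
  omega

end Coordinates

end LowerBound

section UpperBound

variable {V : Type*} {G : SimpleGraph V} {z : Fin 4 → V → ℤ} {g K c N : ℕ} {ε : ℝ}
  {d : Fin 4 → ℤ}

theorem exists_forall_ge_eq_of_monotone_of_finite {α : Type*} {B : ℕ → Set α} (hB : Monotone B)
    {S : Set α} (hS : S.Finite) (hBS : ∀ t, B t ⊆ S) : ∃ T, ∀ t, T ≤ t → B t = B T := by
  have hrange : (range B).Finite := hS.finite_subsets.subset (range_subset_iff.2 hBS)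
  obtain ⟨_, ⟨T, rfl⟩, hmax⟩ := hrange.exists_maximal (range_nonempty B)
  exact ⟨T, fun t ht => (hmax ⟨t, rfl⟩ (hB ht)).antisymm (hB ht)⟩

theorem exists_rect_of_finite (z : Fin 4 → V → ℤ) {B₀ : Set V} (hB₀ : B₀.Finite) :
    ∃ N : ℕ, B₀ ⊆ rect z fun _ => N := by
  obtain ⟨N, hN⟩ := (hB₀.image fun v => ∑ i, (z i v).natAbs).bddAbove
  refine ⟨N, fun v hv i => ?_⟩
  have hsum : ∑ i, (z i v).natAbs ≤ N := hN (mem_image_of_mem _ hv)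
  have hi : (z i v).natAbs ≤ ∑ i, (z i v).natAbs := Finset.single_le_sum
    (f := fun i => (z i v).natAbs) (fun _ _ => Nat.zero_le _) (Finset.mem_univ i)
  change z i v ≤ N
  omega

/-- Four distances at which walls in the four directions can be built, one after another in cyclic
order, before a fire that starts in the square of radius `N` arrives. -/
structure WallDistances (g c N : ℕ) (ε : ℝ) (d : Fin 4 → ℤ) : Prop where
  strictMono : StrictMono d
  zero : 3 * N + c < d 0
  one : g * d 0 + 3 * (g * N) + 2 * c ≤ 2 * ε * (d 1 - N)
  two : g * (d 0 + 2 * d 1) + 3 * (g * N) + 3 * c ≤ 2 * ε * (d 2 - N)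
  three : 2 * (d 0 + d 1 + d 2) + 3 * N + 4 * c ≤ d 3

theorem exists_wallDistances (g c N : ℕ) (hε : 0 < ε) : ∃ d, WallDistances g c N ε d := by
  have hfar : ∀ (l : ℤ) (x : ℝ), ∃ d : ℤ, l < d ∧ x ≤ 2 * ε * (d - N) := by
    intro l x
    obtain ⟨k, hk⟩ := exists_nat_ge (x / (2 * ε))
    refine ⟨max (l + 1) (N + k), by omega, ?_⟩
    rw [div_le_iff₀ (by positivity), mul_comm] at hk
    have hmax : ((N + k : ℤ) : ℝ) ≤ (max (l + 1) (N + k) : ℤ) := by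
      exact_mod_cast le_max_right _ _
    refine hk.trans (mul_le_mul_of_nonneg_left ?_ (by positivity))
    push_cast at hmax ⊢
    linarith
  set d₀ : ℤ := 3 * N + c + 1
  obtain ⟨d₁, h₁, hd₁⟩ := hfar d₀ (g * d₀ + 3 * (g * N) + 2 * c)
  obtain ⟨d₂, h₂, hd₂⟩ := hfar d₁ (g * (d₀ + 2 * d₁) + 3 * (g * N) + 3 * c)
  refine ⟨![d₀, d₁, d₂, 2 * (d₀ + d₁ + d₂) + 3 * N + 4 * c], ?_, ?_, hd₁, hd₂, le_rfl⟩
  · refine Fin.strictMono_iff_lt_succ.2 fun i => ?_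
    fin_cases i
    · exact h₁
    · exact h₂
    · change d₂ < 2 * (d₀ + d₁ + d₂) + 3 * N + 4 * c
      omega
  · exact lt_add_one _

theorem WallDistances.lt (hd : WallDistances g c N ε d) (i : Fin 4) : N < d i := by
  have := hd.zero
  have := hd.strictMono.monotone (Fin.zero_le i)
  omega

/-- While wall `i` is the last one begun, the total length grows at rate `2 * g`; the surplus
`g + 2 * ε` pays for the parts that are already finished. -/
theorem WallDistances.sum_length_le (hd : WallDistances g c N ε d) (hg : 1 ≤ g) (hε : 0 < ε)
    (t : ℕ) : ((∑ i with d i ≤ N + t, (g * (min (d (i + 1)) (N + t) + min (d (i + 3)) (N + t)) + c)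
      : ℤ) : ℝ) ≤ (3 * g + 2 * ε) * t := by
  have h₀₁ : d 0 < d 1 := hd.strictMono (by decide)
  have h₁₂ : d 1 < d 2 := hd.strictMono (by decide)
  have h₂₃ : d 2 < d 3 := hd.strictMono (by decide)
  have hc : (c : ℝ) ≤ g * c := le_mul_of_one_le_left (by positivity) (by exact_mod_cast hg)
  have hεt : 0 ≤ ε * t := by positivity
  have hbuilt : ∀ {x : ℤ}, x ≤ N + t →
      (g : ℝ) * x ≤ g * (N + t) ∧ 2 * ε * (x - N) ≤ 2 * ε * t := fun {x} hx => by
    have hx' : (x : ℝ) ≤ N + t := by exact_mod_cast hx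
    constructor <;> gcongr
    linarith
  simp only [Finset.sum_filter, Fin.sum_univ_four, zero_add, Fin.reduceAdd]
  rcases lt_or_ge (N + t : ℤ) (d 0) with hs | h₀
  · rw [if_neg (by omega), if_neg (by omega), if_neg (by omega), if_neg (by omega)]
    push_cast
    positivity
  rw [if_pos h₀, min_eq_left h₀]
  rcases lt_or_ge (N + t : ℤ) (d 1) with hs | h₁
  · rw [if_neg (by omega), if_neg (by omega), if_neg (by omega), min_eq_right hs.le,
      min_eq_right (by omega)]
    have hzero : (g : ℝ) * (3 * N + c + 1) ≤ g * d 0 := by gcongr; exact_mod_cast hd.zero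
    push_cast
    linarith [hbuilt h₀]
  rw [if_pos h₁, min_eq_left h₁]
  rcases lt_or_ge (N + t : ℤ) (d 2) with hs | h₂
  · rw [if_neg (by omega), if_neg (by omega), min_eq_right hs.le, min_eq_right (by omega)]
    push_cast
    linarith [hd.one, hbuilt h₁]
  rw [if_pos h₂, min_eq_left h₂]
  rcases lt_or_ge (N + t : ℤ) (d 3) with hs | h₃
  · rw [if_neg (by omega), min_eq_right hs.le]
    push_cast
    linarith [hd.two, hbuilt h₂]
  rw [if_pos h₃, min_eq_left h₃]
  have hthree : (g : ℝ) * (2 * (d 0 + d 1 + d 2) + 3 * N + 4 * c) ≤ g * d 3 := by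
    gcongr; exact_mod_cast hd.three
  push_cast
  linarith [hbuilt h₃]

theorem frame_inter_square_subset (z : Fin 4 → V → ℤ) (d : Fin 4 → ℤ) (s : ℤ) :
    frame z d ∩ rect z (fun _ => s) ⊆ ⋃ i ∈ Finset.univ.filter (d · ≤ s),
      side z (fun j => min (d j) s) i := by
  rintro v ⟨⟨i, hvd, hvi⟩, hvs⟩
  have hi : d i ≤ s := hvi ▸ hvs i
  exact mem_iUnion₂.2 ⟨i, by simpa using hi, fun j => le_min (hvd j) (hvs j),
    hvi.trans (min_eq_left hi).symm⟩

namespace Coordinates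

theorem ncard_frame_inter_square_le (h : Coordinates G z g K c) (hd : ∀ i, 0 ≤ d i) {s : ℤ}
    (hs : 0 ≤ s) : 2 * ((frame z d ∩ rect z fun _ => s).ncard : ℤ) ≤
      ∑ i with d i ≤ s, (g * (min (d (i + 1)) s + min (d (i + 3)) s) + c) := by
  have hcover := (ncard_le_ncard (frame_inter_square_subset z d s)
    (Finset.finite_toSet _ |>.biUnion fun i _ => h.side_finite _ i)).trans
    (Finset.set_ncard_biUnion_le _ _)
  zify at hcover
  refine (mul_le_mul_of_nonneg_left hcover zero_le_two).trans ?_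
  rw [Finset.mul_sum]
  exact Finset.sum_le_sum fun i _ => h.side_ncard_le (fun j => min (d j) s) i fun j =>
    add_nonneg (le_min (hd j) hs) (le_min (hd (j + 2)) hs)

theorem ncard_walls_le (h : Coordinates G z g K c) (hg : 1 ≤ g) (hε : 0 < ε)
    (hd : WallDistances g c N ε d) (t : ℕ) :
    ((frame z d ∩ rect z fun _ => N + t).ncard : ℝ) ≤ (3 / 2 * g + ε) * t := by
  have hcount := h.ncard_frame_inter_square_le (fun i => (hd.lt i).le.trans' N.cast_nonneg)
    (s := N + t) (by positivity)
  have hcount' := (Int.cast_le (R := ℝ)).2 hcount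
  have hsum := hd.sum_length_le hg hε t
  push_cast at hcount' hsum
  linarith

theorem burning_subset_of_walls (h : Coordinates G z g K c) {B₀ : Set V}
    (hB₀ : B₀ ⊆ rect z fun _ => N) (hd : ∀ i, N < d i) {F : ℕ → Finset V}
    (hF : ∀ t : ℕ, frame z d ∩ rect z (fun _ => N + t) ⊆ F t) (t : ℕ) :
    burning G B₀ F t ⊆ {v | ∀ i, z i v < d i} := by
  induction t with
  | zero => exact fun v hv i => (hB₀ hv i).trans_lt (hd i)
  | succ t ih =>
    rintro v (hv | ⟨hvF, u, hu, huv⟩)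
    · exact ih hv
    have hvd : v ∈ rect z d := fun i =>
      (h.lipschitz i u v huv).trans (Int.add_one_le_iff.2 (ih hu i))
    have hvN : v ∈ rect z fun _ => N + (t + 1 : ℕ) :=
      h.burning_subset_rect hB₀ F (t + 1) (Or.inr ⟨hvF, u, hu, huv⟩)
    exact fun i => (hvd i).lt_of_ne fun hvi => hvF (hF (t + 1) ⟨⟨i, hvd, hvi⟩, hvN⟩)

theorem containable (h : Coordinates G z g K c) (hg : 1 ≤ g) (hε : 0 < ε) {B₀ : Set V}
    (hB₀ : B₀.Finite) : Containable G (fun t => (3 / 2 * (g : ℝ) + ε) * t) B₀ := by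
  obtain ⟨N, hN⟩ := exists_rect_of_finite z hB₀
  obtain ⟨d, hd⟩ := exists_wallDistances g c N hε
  have hfin : ∀ t : ℕ, (frame z d ∩ rect z fun _ => N + t).Finite := fun t =>
    (h.rect_finite _).inter_of_right _
  set F : ℕ → Finset V := fun t => (hfin t).toFinset
  have hF : ∀ t : ℕ, (F t : Set V) = frame z d ∩ rect z fun _ => N + t := fun t =>
    (hfin t).coe_toFinset
  refine ⟨F, ⟨?_, fun s t hst => ?_, fun t v hv hvF hvB => hvF ?_, fun t _ => ?_⟩, ?_⟩
  · rw [← Finset.coe_eq_empty, hF, eq_empty_iff_forall_notMem]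
    rintro v ⟨⟨i, -, hvi⟩, hvN⟩
    have := hvN i
    have := hd.lt i
    push_cast at *
    omega
  · rw [← Finset.coe_subset, hF, hF]
    exact inter_subset_inter_right _ (rect_mono fun _ => by gcongr)
  · rw [← Finset.mem_coe, hF] at hv ⊢
    exact ⟨hv.1, h.burning_subset_rect hN F t hvB⟩
  · rw [← ncard_coe_finset, hF]
    exact h.ncard_walls_le hg hε hd t
  · exact exists_forall_ge_eq_of_monotone_of_finite (burning_mono G B₀ F)
      ((h.rect_finite d).subset fun v hv i => (hv i).le)
      (h.burning_subset_of_walls hN hd.lt fun t => (hF t).superset)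

theorem isCriticalProtectionRate (h : Coordinates G z g K c) (hg : 1 ≤ g) (hK : 1 ≤ K) :
    IsCriticalProtectionRate G (3 / 2 * (g : ℝ)) :=
  ⟨h.exists_not_containable hg hK, fun _ hε _ hB₀ => h.containable hg hε hB₀⟩

end Coordinates

end UpperBound

section Layers

variable {P ι : Type*} {H : SimpleGraph P} {Γ : SimpleGraph ι}
  {z : Fin 4 → P → ℤ} {r : Fin 4 → ℤ} {g c : ℕ}

theorem le_add_length_mul_of_adj {α : Type*} {Γ : SimpleGraph α} {a : α → ℕ} {L : ℕ}
    (ha : ∀ i j, Γ.Adj i j → a i ≤ a j + L) {i j : α} (p : Γ.Walk i j) :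
    a i ≤ a j + p.length * L := by
  induction p with
  | nil => simp
  | @cons u v w huv p ih =>
    have := ha u v huv
    rw [SimpleGraph.Walk.length_cons, add_one_mul]
    omega

/-- The part of a set of vertices of a layered graph that lies in the layer `k`. -/
def slice (A : Set (P × ι)) (k : ι) : Set P :=
  {p | (p, k) ∈ A}

theorem side_comp_fst (z : Fin 4 → P → ℤ) (r : Fin 4 → ℤ) (i : Fin 4) :
    side (fun i => z i ∘ (Prod.fst : P × ι → P)) r i = side z r i ×ˢ univ :=
  Set.ext fun v => by simp [side, rect]

theorem rect_comp_fst (z : Fin 4 → P → ℤ) (r : Fin 4 → ℤ) :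
    rect (fun i => z i ∘ (Prod.fst : P × ι → P)) r = rect z r ×ˢ univ :=
  Set.ext fun v => by simp [rect]

theorem exits_slice_subset {A : Set (P × ι)} {i : Fin 4} {k l : ι} (hkl : k = l ∨ Γ.Adj k l) :
    exits H z r i (slice A k) ⊆
      slice (exits (H.strongProd Γ) (fun i => z i ∘ Prod.fst) r i A) l := by
  rintro v ⟨hv, u, hu, huv⟩
  exact ⟨hv, (u, k), hu, fun huv' => huv.ne (congrArg Prod.fst huv'), Or.inr huv, hkl⟩

variable [Fintype ι]

theorem pos_of_adj_of_lt_sum (hΓ : Γ.Connected) {a : ι → ℕ} {L : ℕ}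
    (ha : ∀ i j, Γ.Adj i j → a i ≤ a j + L)
    (hlarge : Fintype.card ι * (Fintype.card ι * L) < ∑ i, a i) (j : ι) : 0 < a j := by
  classical
  obtain ⟨i, -, hi⟩ : ∃ i ∈ Finset.univ, Fintype.card ι * L < a i :=
    Finset.exists_lt_of_sum_lt (by simpa using hlarge)
  obtain ⟨p, hp⟩ := (hΓ.preconnected i j).exists_isPath
  have hpath := le_add_length_mul_of_adj ha p
  have hlength : p.length * L ≤ Fintype.card ι * L := Nat.mul_le_mul_right L hp.length_lt.le
  omega

/-- Either some layer gains `g * card ι` from a neighbouring layer, or the number of burning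
vertices varies so little between layers that every layer gains `g` by itself. -/
theorem sum_add_le_sum_of_connected (hΓ : Γ.Connected) {a d : ι → ℕ}
    (had : ∀ i j, i = j ∨ Γ.Adj i j → 0 < a i → a i + g ≤ d j)
    (hlarge : Fintype.card ι * (Fintype.card ι * (g * Fintype.card ι)) < ∑ i, a i) :
    ∑ i, a i + g * Fintype.card ι ≤ ∑ i, d i := by
  classical
  have hle : ∀ i j, i = j ∨ Γ.Adj i j → a i ≤ d j := fun i j hij => by
    have := had i j hij
    omega
  by_cases hjump : ∃ i j, Γ.Adj i j ∧ a j + g * Fintype.card ι < a i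
  · obtain ⟨i, j, hij, hgain⟩ := hjump
    calc ∑ k, a k + g * Fintype.card ι
        = ∑ k, (a k + if k = j then g * Fintype.card ι else 0) := by simp [Finset.sum_add_distrib]
      _ ≤ ∑ k, d k := by
        refine Finset.sum_le_sum fun k _ => ?_
        split_ifs with hk
        · exact hk ▸ hgain.le.trans (hle i j (Or.inr hij))
        · exact hle k k (Or.inl rfl)
  · push Not at hjump
    calc ∑ k, a k + g * Fintype.card ι = ∑ k, (a k + g) := by
          simp [Finset.sum_add_distrib, mul_comm]
      _ ≤ ∑ k, d k := Finset.sum_le_sum fun k _ =>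
        had k k (Or.inl rfl) (pos_of_adj_of_lt_sum hΓ hjump hlarge k)

theorem ncard_eq_sum_slice {A : Set (P × ι)} (hA : ∀ k, (slice A k).Finite) :
    A.ncard = ∑ k, (slice A k).ncard := by
  have hfinite : ∀ k, Finite (slice A k) := fun k => (hA k).to_subtype
  have hequiv : A ≃ Σ k, slice A k :=
    { toFun := fun v => ⟨v.1.2, v.1.1, v.2⟩
      invFun := fun s => ⟨(s.2.1, s.1), s.2.2⟩ }
  exact (Nat.card_congr hequiv).trans Nat.card_sigma

namespace Coordinates

theorem layers_growth (h : Coordinates H z g 1 c) (hΓ : Γ.Connected) {i : Fin 4}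
    {A : Set (P × ι)} (hr : ∀ j, 0 < r j + r (j + 2)) (hA : A ⊆ side (fun i => z i ∘ Prod.fst) r i)
    (hlarge : Fintype.card ι * (Fintype.card ι * (g * Fintype.card ι)) + Fintype.card ι * c
      < A.ncard) :
    (A ∩ openSide (fun i => z i ∘ Prod.fst) r i).ncard + g * Fintype.card ι ≤
      (exits (H.strongProd Γ) (fun i => z i ∘ Prod.fst) r i A).ncard := by
  have hslice : ∀ k, slice A k ⊆ side z r i := fun k _ hp => hA hp
  have hfin : ∀ k, (slice A k).Finite := fun k => (h.side_finite r i).subset (hslice k)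
  have hexits : ∀ k, (slice (exits (H.strongProd Γ) (fun i => z i ∘ Prod.fst) r i A) k).Finite :=
    fun k => (h.front_finite r i).subset fun _ hp => hp.1
  have hopen : ∀ k, (slice A k).ncard ≤ (slice A k ∩ openSide z r i).ncard + c := fun k => by
    simpa only [inter_eq_left.2 (hslice k)] using h.ncard_inter_side_le hr (slice A k) i
  have hcorner : A.ncard ≤ ∑ k, (slice A k ∩ openSide z r i).ncard + Fintype.card ι * c := by
    rw [ncard_eq_sum_slice hfin]
    exact (Finset.sum_le_sum fun k _ => hopen k).trans_eq (by simp [Finset.sum_add_distrib])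
  rw [ncard_eq_sum_slice hexits, ncard_eq_sum_slice fun k => (hfin k).subset fun _ hp => hp.1]
  refine sum_add_le_sum_of_connected hΓ (fun k l hkl hpos => ?_) (by
    change _ < ∑ k, (slice A k ∩ openSide z r i).ncard
    omega)
  have hne : 1 ≤ (slice A k).ncard :=
    hpos.trans_le (ncard_le_ncard (fun _ hp => hp.1) (hfin k))
  exact (h.growth r i (slice A k) hr (hslice k) hne).trans
    (ncard_le_ncard (exits_slice_subset hkl) (hexits l))

theorem layers (h : Coordinates H z g 1 c) (hΓ : Γ.Connected) :
    Coordinates (H.strongProd Γ) (fun i => z i ∘ Prod.fst) (g * Fintype.card ι)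
      (Fintype.card ι * (Fintype.card ι * (g * Fintype.card ι)) + Fintype.card ι * c + 1)
      (c * Fintype.card ι) where
  opposite i v := h.opposite i v.1
  lipschitz i u v := by
    rintro ⟨-, huv | huv, -⟩
    · simp [huv]
    · exact h.lipschitz i _ _ huv
  rect_finite r := by
    rw [rect_comp_fst]
    exact (h.rect_finite r).prod finite_univ
  growth r i A hr hA hlarge := h.layers_growth hΓ hr hA hlarge
  side_ncard_le r i hr := by
    rw [side_comp_fst, ncard_prod, ncard_univ, Nat.card_eq_fintype_card]
    have := mul_le_mul_of_nonneg_right (h.side_ncard_le r i hr)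
      (Int.natCast_nonneg (Fintype.card ι))
    push_cast
    linarith
  le_side_ncard r i hr := by
    rw [side_comp_fst, ncard_prod, ncard_univ, Nat.card_eq_fintype_card]
    have := mul_le_mul_of_nonneg_right (h.le_side_ncard r i hr)
      (Int.natCast_nonneg (Fintype.card ι))
    push_cast
    linarith

end Coordinates

end Layers

section Grids

open scoped Pointwise

variable {P : Type*} [AddGroup P] {H : SimpleGraph P} {z : Fin 4 → P → ℤ} {S : Finset P}
  {g e : ℕ} {r : Fin 4 → ℤ} {i j : Fin 4} {A : Set P} {v : P}

/-- A Cayley graph `H` with steps `S` and two additive coordinates, recorded as four directions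
`z i`, that identify the group with the pairs of integers congruent modulo `e`. Of the steps, at
least `g + 1` lead forward in each direction, and `g` of these do not leave a corner sideways. -/
structure LatticeCoordinates (H : SimpleGraph P) (z : Fin 4 → P → ℤ) (S : Finset P) (g e : ℕ) :
    Prop where
  map_add : ∀ i u v, z i (u + v) = z i u + z i v
  opposite : ∀ i v, z (i + 2) v = -z i v
  eq_of_eq : ∀ i u v, z i u = z i v → z (i + 1) u = z (i + 1) v → u = v
  exists_iff : ∀ i m n, (∃ v, z i v = m ∧ z (i + 1) v = n) ↔ n ≡ m [ZMOD e]
  adj_iff : ∀ u v, H.Adj u v ↔ -u + v ∈ S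
  le_one : ∀ i, ∀ s ∈ S, z i s ≤ 1
  lt_card_forward : ∀ i, g < (S.filter fun s => z i s = 1).card
  le_card_inward : ∀ i j, j = i + 1 ∨ j = i + 3 →
    g ≤ (S.filter fun s => z i s = 1 ∧ z j s ≤ 0).card

namespace LatticeCoordinates

theorem adj_add (h : LatticeCoordinates H z S g e) {s : P} (hs : s ∈ S) : H.Adj v (v + s) :=
  (h.adj_iff v _).2 (by rwa [neg_add_cancel_left])

theorem rect_finite (h : LatticeCoordinates H z S g e) (r : Fin 4 → ℤ) : (rect z r).Finite := by
  have hbox : MapsTo (fun v => (z 0 v, z 1 v)) (rect z r) (Icc (-r 2) (r 0) ×ˢ Icc (-r 3) (r 1)) :=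
    fun v hv => by
      have h₂ := hv 2
      have h₃ := hv 3
      rw [show (2 : Fin 4) = 0 + 2 from rfl, h.opposite] at h₂
      rw [show (3 : Fin 4) = 1 + 2 from rfl, h.opposite] at h₃
      exact ⟨⟨neg_le.1 h₂, hv 0⟩, neg_le.1 h₃, hv 1⟩
  exact ((finite_Icc _ _).prod (finite_Icc _ _)).of_injOn hbox fun u _ v _ huv =>
    h.eq_of_eq 0 u v (congrArg Prod.fst huv) (congrArg Prod.snd huv)

theorem exits_finite (h : LatticeCoordinates H z S g e) (r : Fin 4 → ℤ) (i : Fin 4) (A : Set P) :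
    (exits H z r i A).Finite :=
  (h.rect_finite _).subset fun _ hv => side_subset_rect hv.1

theorem mem_side_iff (h : LatticeCoordinates H z S g e) (hr : 0 ≤ r i + r (i + 2))
    (hv : z i v = r i) :
    v ∈ side z r i ↔ -r (i + 3) ≤ z (i + 1) v ∧ z (i + 1) v ≤ r (i + 1) := by
  have h₃ : z (i + 3) v = -z (i + 1) v := by
    rw [← h.opposite, show i + 1 + 2 = i + 3 by omega]
  have hrect : v ∈ rect z r ↔ ∀ j, z j v ≤ r j := Iff.rfl
  change (_ ∧ _) ↔ _
  rw [hrect, forall_direction_iff i, h.opposite i, h₃]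
  omega

theorem image_side (h : LatticeCoordinates H z S g e) (hr : 0 ≤ r i + r (i + 2)) :
    z (i + 1) '' side z r i =
      ((Finset.Ioc (-r (i + 3) - 1) (r (i + 1))).filter (· ≡ r i [ZMOD e]) : Finset ℤ) := by
  ext n
  simp only [Finset.coe_filter, Finset.mem_Ioc, mem_image, mem_ofPred_eq, ← h.exists_iff i]
  constructor
  · rintro ⟨v, hv, rfl⟩
    have := (h.mem_side_iff hr hv.2).1 hv
    exact ⟨by omega, v, hv.2, rfl⟩
  · rintro ⟨hn, v, hv, rfl⟩
    exact ⟨v, (h.mem_side_iff hr hv).2 (by omega), rfl⟩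

theorem ncard_side (h : LatticeCoordinates H z S g e) (he : 0 < e) (hr : 0 ≤ r i + r (i + 2)) :
    ((side z r i).ncard : ℤ) =
      max ((r (i + 1) - r i) / e - (-r (i + 3) - 1 - r i) / e) 0 := by
  have hinj : InjOn (z (i + 1)) (side z r i) := fun u hu v hv =>
    h.eq_of_eq i u v (hu.2.trans hv.2.symm)
  rw [← hinj.ncard_image, h.image_side hr, ncard_coe_finset,
    Int.Ioc_filter_modEq_card _ _ (by exact_mod_cast he), ← Int.cast_sub, ← Int.cast_sub,
    Int.cast_natCast, Rat.floor_intCast_div_natCast, Rat.floor_intCast_div_natCast]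

theorem add_mem_front_iff (h : LatticeCoordinates H z S g e) {s : P} (hv : z i v = r i)
    (hs : z i s = 1) : v + s ∈ front z r i ↔ ∀ j ≠ i, z j v + z j s ≤ r j := by
  simp [mem_front_iff, h.map_add, hv, hs]

/-- Cauchy–Davenport, applied to the burning vertices of an open side and the forward steps. -/
theorem growth_of_openSide [IsAddTorsionFree P] (h : LatticeCoordinates H z S g e)
    (hA : (A ∩ openSide z r i).Nonempty) :
    (A ∩ openSide z r i).ncard + g ≤ (exits H z r i A).ncard := by
  classical
  have hfin : (A ∩ openSide z r i).Finite :=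
    (h.rect_finite r).subset fun _ hv => hv.2.1.1
  set B : Finset P := hfin.toFinset
  set T : Finset P := S.filter fun s => z i s = 1
  have hforward : g < T.card := h.lt_card_forward i
  have hsub : ↑(B + T) ⊆ exits H z r i A := by
    intro w hw
    obtain ⟨v, hv, s, hs, rfl⟩ := Finset.mem_add.1 (Finset.mem_coe.1 hw)
    obtain ⟨hvA, ⟨hvr, hvi⟩, hopen⟩ := (Finite.mem_toFinset _).1 hv
    obtain ⟨hsS, hsi⟩ := Finset.mem_filter.1 hs
    refine ⟨(h.add_mem_front_iff hvi hsi).2 fun j hj => ?_, v, hvA, h.adj_add hsS⟩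
    have hlt : z j v < r j := (hvr j).lt_of_ne fun hj' => hj (hopen j hj')
    have := h.le_one j s hsS
    omega
  have hB : B.Nonempty := (Finite.toFinset_nonempty hfin).2 hA
  have hsum := cauchy_davenport_of_isAddTorsionFree hB
    (Finset.card_pos.1 (by omega : 0 < T.card))
  have hle := ncard_le_ncard hsub (h.exits_finite r i A)
  rw [ncard_coe_finset] at hle
  have hcard : (A ∩ openSide z r i).ncard = B.card := ncard_eq_toFinset_card _ _
  omega

theorem growth_of_corner (h : LatticeCoordinates H z S g e) (hr : ∀ j, 0 < r j + r (j + 2))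
    (hj : j = i + 1 ∨ j = i + 3) (hvA : v ∈ A) (hv : v ∈ side z r i) (hvj : z j v = r j) :
    g ≤ (exits H z r i A).ncard := by
  classical
  have hsub : ↑((S.filter fun s => z i s = 1 ∧ z j s ≤ 0).image (v + ·)) ⊆ exits H z r i A := by
    intro w hw
    obtain ⟨s, hs, rfl⟩ := Finset.mem_image.1 (Finset.mem_coe.1 hw)
    obtain ⟨hsS, hsi, hsj⟩ := Finset.mem_filter.1 hs
    refine ⟨(h.add_mem_front_iff hv.2 hsi).2 fun k hk => ?_, v, hvA, h.adj_add hsS⟩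
    have hcases : k = i + 2 ∨ k = j ∨ k = j + 2 := by omega
    rcases hcases with rfl | rfl | rfl
    · have := hv.1 (i + 2)
      rw [h.opposite i s]
      omega
    · omega
    · have := hr j
      have := h.le_one (j + 2) s hsS
      rw [h.opposite j v]
      omega
  have hle := ncard_le_ncard hsub (h.exits_finite r i A)
  rw [ncard_coe_finset, Finset.card_image_of_injective _ (add_right_injective v)] at hle
  exact (h.le_card_inward i j hj).trans hle

theorem growth [IsAddTorsionFree P] (h : LatticeCoordinates H z S g e)
    (hr : ∀ j, 0 < r j + r (j + 2)) (hA : A ⊆ side z r i) (hne : A.Nonempty) :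
    (A ∩ openSide z r i).ncard + g ≤ (exits H z r i A).ncard := by
  rcases (A ∩ openSide z r i).eq_empty_or_nonempty with hempty | hopen
  · obtain ⟨v, hvA⟩ := hne
    obtain ⟨j, hvj, hji⟩ : ∃ j, z j v = r j ∧ j ≠ i := by
      by_contra! hopen
      exact (hempty ▸ notMem_empty v : v ∉ A ∩ openSide z r i) ⟨hvA, hA hvA, hopen⟩
    have hopposite : j ≠ i + 2 := by
      rintro rfl
      have := (hA hvA).2
      have := hr i
      rw [h.opposite] at hvj
      omega
    rw [hempty, ncard_empty, zero_add]
    exact h.growth_of_corner hr (by omega) hvA (hA hvA) hvj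
  · exact h.growth_of_openSide hopen

theorem coordinates [IsAddTorsionFree P] (h : LatticeCoordinates H z S g e)
    (heg : e = 1 ∧ g = 2 ∨ e = 2 ∧ g = 1) : Coordinates H z g 1 2 where
  opposite := h.opposite
  lipschitz i u v huv := by
    have hstep := h.le_one i _ ((h.adj_iff u v).1 huv)
    have hadd := h.map_add i u (-u + v)
    rw [add_neg_cancel_left] at hadd
    omega
  rect_finite := h.rect_finite
  growth r i A hr hA hne := h.growth hr hA (nonempty_of_ncard_ne_zero (by omega))
  side_ncard_le r i hr := by
    have := hr (i + 1)
    rw [show i + 1 + 2 = i + 3 by omega] at this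
    rw [h.ncard_side (by omega) (hr i)]
    rcases heg with ⟨rfl, rfl⟩ | ⟨rfl, rfl⟩ <;> push_cast <;> omega
  le_side_ncard r i hr := by
    rw [h.ncard_side (by omega) (hr i)]
    rcases heg with ⟨rfl, rfl⟩ | ⟨rfl, rfl⟩ <;> push_cast <;> omega

end LatticeCoordinates

theorem intPath_adj {a b : ℤ} : intPath.Adj a b ↔ a + 1 = b ∨ b + 1 = a := by
  rw [SimpleGraph.hasse_adj, Order.covBy_iff_add_one_eq, Order.covBy_iff_add_one_eq]

theorem grid_adj {u v : ℤ × ℤ} : (intPath.boxProd intPath).Adj u v ↔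
    -u + v ∈ ({(1, 0), (0, 1), (-1, 0), (0, -1)} : Finset (ℤ × ℤ)) := by
  simp only [SimpleGraph.boxProd_adj, intPath_adj, Finset.mem_insert, Finset.mem_singleton,
    Prod.ext_iff, Prod.fst_add, Prod.snd_add, Prod.fst_neg, Prod.snd_neg]
  omega

theorem strongGrid_adj {u v : ℤ × ℤ} : (intPath.strongProd intPath).Adj u v ↔
    -u + v ∈ ({(1, 0), (1, 1), (0, 1), (-1, 1), (-1, 0), (-1, -1), (0, -1), (1, -1)} :
      Finset (ℤ × ℤ)) := by
  change u ≠ v ∧ (u.1 = v.1 ∨ intPath.Adj u.1 v.1) ∧ (u.2 = v.2 ∨ intPath.Adj u.2 v.2) ↔ _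
  simp only [intPath_adj, Finset.mem_insert, Finset.mem_singleton, Prod.ext_iff, Prod.fst_add,
    Prod.snd_add, Prod.fst_neg, Prod.snd_neg, ne_eq]
  omega

theorem grid_coordinates :
    Coordinates (intPath.boxProd intPath)
      ![fun v => v.1 + v.2, fun v => v.2 - v.1, fun v => -(v.1 + v.2), fun v => -(v.2 - v.1)]
      1 1 2 :=
  LatticeCoordinates.coordinates (e := 2)
    { map_add := fun i u v => by fin_cases i <;> simp <;> ring
      opposite := fun i v => by fin_cases i <;> simp
      eq_of_eq := fun i u v h h' => by fin_cases i <;> simp [Prod.ext_iff] at * <;> omega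
      exists_iff := fun i m n => by
        refine ⟨?_, fun h => ⟨![((m - n) / 2, (m + n) / 2), ((-n - m) / 2, (m - n) / 2),
          ((n - m) / 2, (-m - n) / 2), ((m + n) / 2, (n - m) / 2)] i, ?_⟩⟩
        · rintro ⟨v, rfl, rfl⟩
          fin_cases i <;> simp [Int.ModEq] <;> omega
        · simp only [Int.ModEq] at h
          fin_cases i <;> simp <;> omega
      adj_iff := fun _ _ => grid_adj
      le_one := by decide
      lt_card_forward := by decide
      le_card_inward := by decide } (by omega)

theorem strongGrid_coordinates :
    Coordinates (intPath.strongProd intPath)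
      ![fun v => v.1, fun v => v.2, fun v => -v.1, fun v => -v.2] 2 1 2 :=
  LatticeCoordinates.coordinates (e := 1)
    { map_add := fun i u v => by fin_cases i <;> simp [add_comm]
      opposite := fun i v => by fin_cases i <;> simp
      eq_of_eq := fun i u v h h' => by fin_cases i <;> simp [Prod.ext_iff] at * <;> omega
      exists_iff := fun i m n => by
        refine ⟨fun _ => Int.modEq_one, fun _ => ⟨![(m, n), (-n, m), (-m, -n), (n, -m)] i, ?_⟩⟩
        fin_cases i <;> simp
      adj_iff := fun _ _ => strongGrid_adj
      le_one := by decide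
      lt_card_forward := by decide
      le_card_inward := by decide } (by omega)

end Grids

end Firefighter

open Firefighter in
theorem mainTheorem3_general {ι : Type*} [Fintype ι] {Γ : SimpleGraph ι} (hΓ : Γ.Connected) :
    IsCriticalProtectionRate ((intPath.boxProd intPath).strongProd Γ)
        (3 / 2 * (Fintype.card ι : ℝ)) ∧
      IsCriticalProtectionRate ((intPath.strongProd intPath).strongProd Γ)
        (3 * (Fintype.card ι : ℝ)) := by
  have hcard : 0 < Fintype.card ι := Fintype.card_pos_iff.2 hΓ.nonempty
  have hgrid := (grid_coordinates.layers hΓ).isCriticalProtectionRate (by omega) (by omega)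
  have hstrong := (strongGrid_coordinates.layers hΓ).isCriticalProtectionRate (by omega) (by omega)
  push_cast at hgrid hstrong
  exact ⟨by rwa [one_mul] at hgrid, by rwa [← mul_assoc, div_mul_cancel₀ _ two_ne_zero] at hstrong⟩

theorem mainTheorem3 (h : ℕ) (hh : 1 ≤ h) :
    Firefighter.IsCriticalProtectionRate
        ((Firefighter.intPath.boxProd Firefighter.intPath).strongProd (SimpleGraph.pathGraph h))
        (3 / 2 * (h : ℝ)) ∧
      Firefighter.IsCriticalProtectionRate
        ((Firefighter.intPath.strongProd Firefighter.intPath).strongProd (SimpleGraph.pathGraph h))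
        (3 * (h : ℝ)) := by
  have : Nonempty (Fin h) := ⟨⟨0, hh⟩⟩
  simpa only [Fintype.card_fin] using
    mainTheorem3_general ⟨SimpleGraph.pathGraph_preconnected h⟩
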